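/- Let $A$ and $B$ be (not necessarily unital) $C^*$-algebras, and let $V$ be a complex normed space with an $A$–$B$ bimodule structure (bilinear over $\mathbb{C}$) that is essential, i.e. the linear spans of $AV$ and of $VB$ are dense in $V$. Suppose that $V$ is *representable*, i.e. satisfies $$\|a_1v_1b_1+a_2v_2b_2\|\le\|a_1a_1^*+a_2a_2^*\|^{1/2}\,\|b_1^*b_1+b_2^*b_2\|^{1/2}$$ for all $a_1,a_2\in A$, $b_1,b_2\in B$ and all $v_1,v_2\in V$ with $\|v_1\|,\|v_2\|\le 1$. Suppose moreover that $V$ is *dual*: $V$ is (isometrically) the dual of a Banach space $V_*$, and for all $a\in A$, $b\in B$ the maps $v\mapsto av$ and $v\mapsto vb$ are $\sigma(V,V_*)$-continuous. Then there exist a Hilbert space $H$, two $*$-representations $\pi:A\to\mathcal{B}(H)$ and $\rho:B\to\mathcal{B}(H)$ (possibly degenerate), and a linear isometry $J:V\to\mathcal{B}(H)$, continuous for the weak* topologies $\sigma(V,V_*)$ and $\sigma(\mathcal{B}(H),\mathcal{B}(H)_*)$, which is a morphism of bimodules: for all $a\in A$, $v\in V$, $b\in B$, $$J(av)=\pi(a)J(v),\qquad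 J(vb)=J(v)\rho(b),\qquad J(avb)=\pi(a)J(v)\rho(b).$$ Say that $V$ is *left normal* if $A$ is a $W^*$-algebra (a $C^*$-algebra that is isometrically the dual of a Banach space $A_*$) and, for every $F\in V_*$ and $v\in V$, the functional $a\mapsto F(av)$ belongs to $A_*$; say that $V$ is *right normal* if $B$ is a $W^*$-algebra and, for every $F\in V_*$ and $v\in V$, the functional $b\mapsto F(vb)$ belongs to $B_*$. Then $H,\pi,\rho,J$ can be chosen so that, in addition, $\pi$ is normal (that is, continuous from $\sigma(A,A_*)$ to $\sigma(\mathcal{B}(H),\mathcal{B}(H)_*)$) if $V$ is left normal, and $\rho$ is normal if $V$ is right normal; both if $V$ is left and right normal. -/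

import Mathlib

universe u v w

/-- The weak topology `σ(E, S)` on `E` defined by a set `S` of bounded linear functionals. -/
@[reducible]
noncomputable def weakTopologyOf {E : Type*} [NormedAddCommGroup E] [NormedSpace ℂ E]
    (S : Set (StrongDual ℂ E)) : TopologicalSpace E :=
  TopologicalSpace.induced (fun (x : E) (F : S) => (F : StrongDual ℂ E) x) Pi.topologicalSpace

/-- `P` is a predual of `E`: a Banach space `P = E_*`, embedded in `E^*` as a (norm) closed
subspace, such that the evaluation map `E → P^*` is isometric (the norm of `x` is the norm of
the functional `F ↦ F x` on `P`) and onto (every bounded functional on `P` is of this form).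
Every Banach space whose dual is isometric to `E` is, through its canonical embedding in its
bidual, of this form. -/
structure IsPredual {E : Type*} [NormedAddCommGroup E] [NormedSpace ℂ E]
    (P : Submodule ℂ (StrongDual ℂ E)) : Prop where
  isClosed : IsClosed (P : Set (StrongDual ℂ E))
  isometry : ∀ x : E, IsLUB {r : ℝ | ∃ F ∈ P, ‖F‖ ≤ 1 ∧ r = ‖F x‖} ‖x‖
  surjective : ∀ Φ : P →ₗ[ℂ] ℂ, (∃ C : ℝ, ∀ F : P, ‖Φ F‖ ≤ C * ‖(F : StrongDual ℂ E)‖) →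
    ∃ x : E, ∀ F : P, Φ F = (F : StrongDual ℂ E) x

/-- The functionals `T ↦ ∑ₙ ⟪ηₙ, T ξₙ⟫` on `B(H)`, with `∑ ‖ξₙ‖² < ∞` and `∑ ‖ηₙ‖² < ∞`.
These are the functionals `T ↦ Tr (T t)` with `t` of trace class, i.e. the elements of `B(H)_*`;
hence `weakTopologyOf (normalFunctionals H)` is the weak* (ultraweak) topology of `B(H)`. -/
def normalFunctionals (H : Type*) [NormedAddCommGroup H] [InnerProductSpace ℂ H] :
    Set (StrongDual ℂ (H →L[ℂ] H)) :=
  {ω | ∃ ξ η : ℕ → H, Summable (fun n => ‖ξ n‖ ^ 2) ∧ Summable (fun n => ‖η n‖ ^ 2) ∧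
    ∀ T : H →L[ℂ] H, HasSum (fun n => inner ℂ (η n) (T (ξ n))) (ω T)}

/-- A representation of a C*-algebra `A` with predual `PA` is normal if it is continuous for the
weak* topologies `σ(A, A_*)` and `σ(B(H), B(H)_*)`. -/
def IsNormalRep {A H : Type*} [NonUnitalCStarAlgebra A] [NormedAddCommGroup H]
    [InnerProductSpace ℂ H] [CompleteSpace H] (PA : Submodule ℂ (StrongDual ℂ A))
    (π : A →⋆ₙₐ[ℂ] (H →L[ℂ] H)) : Prop :=
  @Continuous A (H →L[ℂ] H) (weakTopologyOf (PA : Set (StrongDual ℂ A)))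
    (weakTopologyOf (normalFunctionals H)) π

/-- The structure of an `A`–`B` bimodule on the complex vector space `V`, where `A` and `B` need
not be unital: `lact a v` is `av` and `ract b v` is `vb`. -/
structure CStarBimodule (A B V : Type*) [NonUnitalCStarAlgebra A] [NonUnitalCStarAlgebra B]
    [NormedAddCommGroup V] [NormedSpace ℂ V] where
  lact : A →ₗ[ℂ] V →ₗ[ℂ] V
  ract : B →ₗ[ℂ] V →ₗ[ℂ] V
  lact_mul : ∀ (a a' : A) (v : V), lact (a * a') v = lact a (lact a' v)
  ract_mul : ∀ (b b' : B) (v : V), ract (b * b') v = ract b' (ract b v)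
  lact_ract : ∀ (a : A) (b : B) (v : V), lact a (ract b v) = ract b (lact a v)

namespace CStarBimodule

variable {A B V : Type*} [NonUnitalCStarAlgebra A] [NonUnitalCStarAlgebra B]
  [NormedAddCommGroup V] [NormedSpace ℂ V]

/-- `V` is essential: `AV` and `VB` span dense subspaces of `V`. -/
structure IsEssential (M : CStarBimodule A B V) : Prop where
  left : (Submodule.span ℂ {w : V | ∃ a v, w = M.lact a v}).topologicalClosure = ⊤
  right : (Submodule.span ℂ {w : V | ∃ b v, w = M.ract b v}).topologicalClosure = ⊤

/-- Condition (R): `‖a₁v₁b₁ + a₂v₂b₂‖ ≤ ‖a₁a₁* + a₂a₂*‖^(1/2) ‖b₁*b₁ + b₂*b₂‖^(1/2)` whenever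
`‖v₁‖, ‖v₂‖ ≤ 1`. -/
def PropertyR (M : CStarBimodule A B V) : Prop :=
  ∀ (a₁ a₂ : A) (b₁ b₂ : B) (v₁ v₂ : V), ‖v₁‖ ≤ 1 → ‖v₂‖ ≤ 1 →
    ‖M.lact a₁ (M.ract b₁ v₁) + M.lact a₂ (M.ract b₂ v₂)‖ ≤
      Real.sqrt ‖a₁ * star a₁ + a₂ * star a₂‖ * Real.sqrt ‖star b₁ * b₁ + star b₂ * b₂‖

/-- Representable bimodules: essential bimodules satisfying condition (R). -/
structure IsRepresentable (M : CStarBimodule A B V) : Prop where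
  essential : M.IsEssential
  propertyR : M.PropertyR

/-- `V` is a dual representable bimodule with predual `PV = V_*`: the maps `v ↦ av` and
`v ↦ vb` are `σ(V, V_*)`-continuous. -/
structure IsDualRepresentable (M : CStarBimodule A B V)
    (PV : Submodule ℂ (StrongDual ℂ V)) : Prop where
  representable : M.IsRepresentable
  isPredual : IsPredual PV
  continuous_lact : ∀ a : A,
    @Continuous V V (weakTopologyOf (PV : Set (StrongDual ℂ V)))
      (weakTopologyOf (PV : Set (StrongDual ℂ V))) (fun v => M.lact a v)
  continuous_ract : ∀ b : B,
    @Continuous V V (weakTopologyOf (PV : Set (StrongDual ℂ V)))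
      (weakTopologyOf (PV : Set (StrongDual ℂ V))) (fun v => M.ract b v)

/-- Left normality: `A` is a W*-algebra with predual `PA = A_*`, and `a ↦ F(av)` belongs to `A_*`
for all `F ∈ V_*` and `v ∈ V`. -/
structure IsLeftNormal (M : CStarBimodule A B V) (PV : Submodule ℂ (StrongDual ℂ V))
    (PA : Submodule ℂ (StrongDual ℂ A)) : Prop where
  isPredual : IsPredual PA
  normal : ∀ F ∈ PV, ∀ v : V, ∃ φ ∈ PA, ∀ a : A, φ a = F (M.lact a v)

/-- Right normality: `B` is a W*-algebra with predual `PB = B_*`, and `b ↦ F(vb)` belongs to `B_*`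
for all `F ∈ V_*` and `v ∈ V`. -/
structure IsRightNormal (M : CStarBimodule A B V) (PV : Submodule ℂ (StrongDual ℂ V))
    (PB : Submodule ℂ (StrongDual ℂ B)) : Prop where
  isPredual : IsPredual PB
  normal : ∀ F ∈ PV, ∀ v : V, ∃ ψ ∈ PB, ∀ b : B, ψ b = F (M.ract b v)

end CStarBimodule

/-! ### Operators from sesquilinear forms, coefficient functionals, compressions -/

section FunctionalAnalysis

open ContinuousLinearMap

/-! The core is a factorization: every `F` in the unit ball of `V_*` satisfies |F(avb)| ≤ ‖v‖
φ(aa*)^{1/2} ψ(b*b)^{1/2} for positive functionals φ on `A` and ψ on `B` bounded by the norm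
(`PropertyR.exists_positiveLinearMap`). They come from Hahn–Banach, applied to the infimum p(x, y)
of ‖x + aa*‖ + ‖y + b*b‖ - 2 Re F(avb). Condition (R) makes p subadditive: two triples (a₁, v₁, b₁),
(a₂, v₂, b₂) merge approximately into one, with aa* = a₁a₁* + a₂a₂* and b*b = b₁*b₁ + b₂*b₂
(`PropertyR.exists_combination`). A real functional g ≤ p satisfies g(x, y) ≤ ‖x‖ + ‖y‖ and 2 Re
F(avb) ≤ g(aa*, b*b); a scaling argument turns the latter into the product bound.

On the GNS spaces of φ and ψ, the form (x, y) ↦ F(x*vy) then defines an operator J_F(v) of norm at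
most ‖v‖, intertwining the actions. Approximate units give |F(v)| ≤ ‖J_F(v)‖, so the direct sum over
the unit ball of `V_*` is isometric. Its coefficients at GNS vectors are the functionals v ↦ F(x*vy)
or zero; these lie in `V_*` because the actions are weak* continuous, and since `V_*` is closed all
coefficients do, which gives weak* continuity.

The GNS representations need not be normal. However, only the action of π on the closed span of
J(V)H, and of ρ on that of J(V)*H, is seen by J. Cutting down to these subspaces
(`exists_compression`) leaves coefficients of the form a ↦ ⟪η, J(av)ζ⟫, which are normal exactly by
left normality, and symmetrically on the right. The same pair of representations therefore serves
all cases. -/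

/-- A bounded sesquilinear form defined on dense ranges is given by a bounded operator. -/
theorem exists_clm_of_sesquilinear_bound {E G H K : Type*} [AddCommGroup E] [Module ℂ E]
    [AddCommGroup G] [Module ℂ G] [NormedAddCommGroup H] [InnerProductSpace ℂ H] [CompleteSpace H]
    [NormedAddCommGroup K] [InnerProductSpace ℂ K] [CompleteSpace K]
    (i : E →ₗ[ℂ] H) (hi : DenseRange i) (j : G →ₗ[ℂ] K) (hj : DenseRange j)
    (β : E →ₗ⋆[ℂ] G →ₗ[ℂ] ℂ) {C : ℝ} (hC : 0 ≤ C)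
    (hβ : ∀ x y, ‖β x y‖ ≤ C * ‖i x‖ * ‖j y‖) :
    ∃ T : K →L[ℂ] H, (∀ x y, inner ℂ (i x) (T (j y)) = β x y) ∧ ‖T‖ ≤ C := by
  have hext : ∀ x y, (β x).extendOfNorm j (j y) = β x y := fun x y =>
    LinearMap.extendOfNorm_eq hj ⟨_, hβ x⟩ y
  -- Riesz vectors: both `β` and the Riesz map are conjugate-linear in the relevant variable, so `x
  -- ↦ g x` is linear.
  set g : E → K := fun x => (InnerProductSpace.toDual ℂ K).symm ((β x).extendOfNorm j) with hg
  have hgi : ∀ x y, inner ℂ (g x) (j y) = β x y := fun x y => by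
    rw [hg, InnerProductSpace.toDual_symm_apply, hext]
  have huniq : ∀ k k' : K, (∀ y, inner ℂ k (j y) = inner ℂ k' (j y)) → k = k' := fun k k' h =>
    Dense.eq_of_inner_left ℂ hj (by rintro _ ⟨y, rfl⟩; exact h y)
  let f : E →ₗ[ℂ] K :=
    { toFun := g
      map_add' := fun x x' => huniq _ _ fun y => by
        simp only [inner_add_left, hgi, map_add, LinearMap.add_apply]
      map_smul' := fun c x => huniq _ _ fun y => by
        simp only [inner_smul_left, hgi, RingHom.id_apply, LinearMap.map_smulₛₗ,
          LinearMap.smul_apply, smul_eq_mul] }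
  have hf : ∀ x, ‖f x‖ ≤ C * ‖i x‖ := fun x => by
    change ‖(InnerProductSpace.toDual ℂ K).symm ((β x).extendOfNorm j)‖ ≤ _
    rw [LinearIsometryEquiv.norm_map]
    exact LinearMap.opNorm_extendOfNorm_le hj (by positivity) (hβ x)
  refine ⟨adjoint (f.extendOfNorm i), fun x y => ?_, ?_⟩
  · rw [adjoint_inner_right, LinearMap.extendOfNorm_eq hi ⟨C, hf⟩]
    exact hgi x y
  · rw [LinearIsometryEquiv.norm_map]
    exact LinearMap.opNorm_extendOfNorm_le hi hC hf

variable {V H K : Type*} [NormedAddCommGroup V] [NormedSpace ℂ V]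
  [NormedAddCommGroup H] [InnerProductSpace ℂ H]
  [NormedAddCommGroup K] [InnerProductSpace ℂ K]

/-- The coefficient functional `v ↦ ⟪η, J v ξ⟫`. -/
noncomputable def coeffFunctional (J : V →L[ℂ] (K →L[ℂ] H)) (η : H) (ξ : K) : StrongDual ℂ V :=
  (innerSL ℂ η) ∘L (ContinuousLinearMap.apply ℂ H ξ) ∘L J

@[simp]
theorem coeffFunctional_apply (J : V →L[ℂ] (K →L[ℂ] H)) (η : H) (ξ : K) (v : V) :
    coeffFunctional J η ξ v = inner ℂ η (J v ξ) := rfl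

theorem norm_coeffFunctional_le (J : V →L[ℂ] (K →L[ℂ] H)) (η : H) (ξ : K) :
    ‖coeffFunctional J η ξ‖ ≤ ‖J‖ * (‖η‖ * ‖ξ‖) := by
  refine opNorm_le_bound _ (by positivity) fun v => ?_
  calc ‖inner ℂ η (J v ξ)‖ ≤ ‖η‖ * ‖J v ξ‖ := norm_inner_le_norm _ _
    _ ≤ ‖η‖ * (‖J‖ * ‖v‖ * ‖ξ‖) := by
      gcongr
      exact (le_opNorm _ _).trans (by gcongr; exact le_opNorm _ _)
    _ = _ := by ring

/-- If a closed subspace contains the coefficient functionals of two total sets of vectors, it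
contains all coefficient functionals. -/
theorem coeffFunctional_mem_of_total (J : V →L[ℂ] (K →L[ℂ] H)) {P : Submodule ℂ (StrongDual ℂ V)}
    (hP : IsClosed (P : Set (StrongDual ℂ V))) {S : Set H} {R : Set K}
    (hS : Dense (Submodule.span ℂ S : Set H)) (hR : Dense (Submodule.span ℂ R : Set K))
    (h : ∀ η ∈ S, ∀ ξ ∈ R, coeffFunctional J η ξ ∈ P) (η : H) (ξ : K) :
    coeffFunctional J η ξ ∈ P := by
  have h1 : ∀ ξ ∈ R, ∀ η, coeffFunctional J η ξ ∈ P := by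
    intro ξ hξ η
    have hc : Continuous fun η : H => coeffFunctional J η ξ := by
      unfold coeffFunctional
      fun_prop
    refine hS.induction (P := fun η => coeffFunctional J η ξ ∈ P) ?_ (hP.preimage hc) η
    intro η hη
    induction hη using Submodule.span_induction with
    | mem x hx => exact h x hx ξ hξ
    | zero =>
      convert P.zero_mem
      ext v; simp
    | add x y _ _ hx hy =>
      convert P.add_mem hx hy
      ext v; simp
    | smul c x _ hx =>
      convert P.smul_mem (starRingEnd ℂ c) hx
      ext v; simp [mul_comm]
  have hc : Continuous fun ξ : K => coeffFunctional J η ξ := by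
    unfold coeffFunctional
    fun_prop
  refine hR.induction (P := fun ξ => coeffFunctional J η ξ ∈ P) ?_ (hP.preimage hc) ξ
  intro ξ hξ
  induction hξ using Submodule.span_induction with
  | mem x hx => exact h1 x hx η
  | zero =>
    convert P.zero_mem
    ext v; simp
  | add x y _ _ hx hy =>
    convert P.add_mem hx hy
    ext v; simp
  | smul c x _ hx =>
    convert P.smul_mem c hx
    ext v; simp

/-- A closed subspace which contains all coefficient functionals of `J` contains `ω ∘ J` for all
normal functionals `ω`. -/
theorem comp_mem_of_coeffFunctional_mem (J : V →L[ℂ] (H →L[ℂ] H))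
    {P : Submodule ℂ (StrongDual ℂ V)} (hP : IsClosed (P : Set (StrongDual ℂ V)))
    (h : ∀ η ξ, coeffFunctional J η ξ ∈ P) {ω : StrongDual ℂ (H →L[ℂ] H)}
    (hω : ω ∈ normalFunctionals H) : ω ∘L J ∈ P := by
  obtain ⟨ξ, η, hξ, hη, hT⟩ := hω
  have hs : Summable fun n => coeffFunctional J (η n) (ξ n) := by
    refine Summable.of_norm_bounded (g := fun n => ‖J‖ * (‖η n‖ ^ 2 + ‖ξ n‖ ^ 2))
      ((hη.add hξ).mul_left _) fun n => (norm_coeffFunctional_le _ _ _).trans ?_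
    gcongr
    nlinarith [sq_nonneg (‖η n‖ - ‖ξ n‖), sq_nonneg (‖η n‖), sq_nonneg (‖ξ n‖)]
  have heq : ω ∘L J = ∑' n, coeffFunctional J (η n) (ξ n) := by
    ext v
    have h1 := (ContinuousLinearMap.apply ℂ ℂ v).hasSum hs.hasSum
    exact (hT (J v)).unique h1
  rw [heq]
  exact hP.mem_of_tendsto hs.hasSum
    (Filter.Eventually.of_forall fun s => P.sum_mem fun n _ => h _ _)

theorem continuous_weakTopologyOf_of_comp_mem {E F : Type*} [NormedAddCommGroup E]
    [NormedSpace ℂ E] [NormedAddCommGroup F] [NormedSpace ℂ F] {S : Set (StrongDual ℂ E)}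
    {R : Set (StrongDual ℂ F)} (f : E → F)
    (h : ∀ ω ∈ R, ∃ φ ∈ S, ∀ x, φ x = ω (f x)) :
    @Continuous E F (weakTopologyOf S) (weakTopologyOf R) f := by
  let _ : TopologicalSpace E := weakTopologyOf S
  refine continuous_induced_rng.2 (continuous_pi fun ω => ?_)
  obtain ⟨φ, hφ, hx⟩ := h ω ω.2
  have h1 : Continuous (fun (x : E) (F : S) => F.1 x : E → S → ℂ) := continuous_induced_dom
  exact ((continuous_apply (⟨φ, hφ⟩ : S)).comp h1).congr hx

/-- A functional continuous for the topology induced by a family of functionals is a linear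
combination of finitely many of them, and `P` is already a subspace. -/
theorem mem_of_continuous_weakTopologyOf {E : Type*} [NormedAddCommGroup E]
    [NormedSpace ℂ E] {P : Submodule ℂ (StrongDual ℂ E)} (f : StrongDual ℂ E)
    (h : @Continuous E ℂ (weakTopologyOf (P : Set (StrongDual ℂ E))) _ f) : f ∈ P := by
  have h1 := (LinearMap.mem_span_iff_continuous
    (f := fun F : P => ((F : StrongDual ℂ E) : E →ₗ[ℂ] ℂ)) (f : E →ₗ[ℂ] ℂ)).2 (by
      rw [← induced_to_pi]
      exact h)
  have h2 : (f : E →ₗ[ℂ] ℂ) ∈ P.map (ContinuousLinearMap.coeLM ℂ) := by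
    refine Submodule.span_le.2 ?_ h1
    rintro _ ⟨F, rfl⟩
    exact ⟨F, F.2, rfl⟩
  obtain ⟨F, hF, hFf⟩ := h2
  have : F = f := by
    ext x
    exact LinearMap.congr_fun hFf x
  exact this ▸ hF

/-- A representation can be cut down to the closed span of an invariant set. -/
theorem exists_compression {A : Type*} [NonUnitalCStarAlgebra A] [CompleteSpace H]
    (π : A →⋆ₙₐ[ℂ] (H →L[ℂ] H)) (S : Set H) (hS : ∀ a, ∀ x ∈ S, π a x ∈ S) :
    ∃ π' : A →⋆ₙₐ[ℂ] (H →L[ℂ] H), (∀ a, ∀ x ∈ S, π' a x = π a x) ∧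
      ∃ S' : Set H, Dense (Submodule.span ℂ S' : Set H) ∧
        ∀ x ∈ S', x ∈ S ∨ ∀ a, π' a x = 0 := by
  set L : Submodule ℂ H := (Submodule.span ℂ S).topologicalClosure with hL
  have hLc : IsClosed (L : Set H) := Submodule.isClosed_topologicalClosure _
  have : CompleteSpace L := hLc.completeSpace_coe
  have hSL : S ⊆ L := Submodule.subset_span.trans (Submodule.le_topologicalClosure _)
  set p : H →L[ℂ] H := L.starProjection with hp
  have hpS : ∀ x ∈ L, p x = x := fun x hx => Submodule.starProjection_eq_self_iff.2 hx
  have hinv : ∀ a, ∀ x ∈ L, π a x ∈ L := by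
    intro a x hx
    have h1 : Submodule.span ℂ S ≤ (L.comap (π a : H →ₗ[ℂ] H)) :=
      Submodule.span_le.2 fun y hy => hSL (hS a y hy)
    have h2 : L ≤ L.comap (π a : H →ₗ[ℂ] H) :=
      Submodule.topologicalClosure_minimal _ h1 (hLc.preimage (π a).continuous)
    exact h2 hx
  have hpsa : star p = p := (isSelfAdjoint_starProjection L).star_eq
  have h1 : ∀ a, p * π a * p = π a * p := fun a => by
    ext x
    exact hpS _ (hinv a _ (Submodule.starProjection_apply_mem L x))
  -- `L` is invariant under a star-closed family, hence reducing: take adjoints in `h1` for `star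
  -- a`.
  have h2 : ∀ a, p * π a = π a * p := fun a => by
    have := congrArg star (h1 (star a))
    simp only [star_mul, hpsa, ← map_star, star_star] at this
    rw [← this, ← mul_assoc, h1]
  refine ⟨{ toFun := fun a => π a * p
            map_smul' := fun c a => by simp
            map_zero' := by simp
            map_add' := fun a b => by simp [add_mul]
            map_mul' := fun a b => by
              rw [map_mul, mul_assoc (π a) p, ← mul_assoc p, h1, mul_assoc]
            map_star' := fun a => by rw [star_mul, hpsa, map_star, ← map_star, h2] }, ?_,
          -- The compressed representation vanishes on `Lᗮ`, so adjoining it to `S` gives a total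
          -- set on which coefficients are still controlled.
          S ∪ Lᗮ, ?_, ?_⟩
  · intro a x hx
    change π a (p x) = _
    rw [hpS x (hSL hx)]
  · rw [Submodule.dense_iff_topologicalClosure_eq_top,
      Submodule.topologicalClosure_eq_top_iff, eq_bot_iff]
    intro x hx
    have hx1 : x ∈ Lᗮ := by
      rw [hL, Submodule.orthogonal_closure]
      exact Submodule.orthogonal_le (Submodule.span_mono Set.subset_union_left) hx
    have := (Submodule.mem_orthogonal _ _).1 hx x (Submodule.subset_span (Or.inr hx1))
    simpa using this
  · rintro x (hx | hx)
    · exact Or.inl hx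
    · right
      intro a
      change π a (p x) = 0
      rw [hp, (Submodule.starProjection_apply_eq_zero_iff (K := L)).2 hx, map_zero]

end FunctionalAnalysis

/-! ### Approximate polar factorization of a row of two elements -/

section CStarAlgebraFactorization

open CFC

/-- Two elements `a₁, a₂` of a C*-algebra are, up to `ε`, of the form `r c₁, r c₂` where `(c₁ c₂)` is
a row contraction and `r r^* = a₁ a₁^* + a₂ a₂^*`. -/
theorem exists_row_factorization {A : Type*} [NonUnitalCStarAlgebra A] (a₁ a₂ : A) {ε : ℝ}
    (hε : 0 < ε) :
    ∃ r c₁ c₂ : A, star r = r ∧ r * r = a₁ * star a₁ + a₂ * star a₂ ∧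
      ‖c₁ * star c₁ + c₂ * star c₂‖ ≤ 1 ∧ ‖r * c₁ - a₁‖ ≤ ε ∧ ‖r * c₂ - a₂‖ ≤ ε := by
  let _ : PartialOrder A := CStarAlgebra.spectralOrder A
  have _ : StarOrderedRing A := CStarAlgebra.spectralOrderedRing A
  set s := a₁ * star a₁ + a₂ * star a₂ with hs
  have hs0 : 0 ≤ s := add_nonneg (mul_star_self_nonneg _) (mul_star_self_nonneg _)
  have hsa : IsSelfAdjoint s := .of_nonneg hs0
  have hq : ∀ t ∈ quasispectrum ℝ s, 0 ≤ t := fun t ht => quasispectrum_nonneg_of_nonneg s hs0 t ht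
  -- The error is measured through `x * star x`, whence the square of `ε`.
  have hδ : 0 < ε ^ 2 := by positivity
  set δ := ε ^ 2
  have hne : ∀ t : ℝ, |t| + δ ≠ 0 := fun t => by positivity
  set f : ℝ → ℝ := fun t => √t with hf
  -- A regularized t^{-1/2}, so that `g` replaces the possibly missing inverse of `r` and `c i = g *
  -- a i`. The absolute value makes `h` continuous on all of ℝ.
  set h : ℝ → ℝ := fun t => √t / (|t| + δ) with hh
  set k : ℝ → ℝ := fun t => √t * (√t / (|t| + δ)) with hk
  have hfc : Continuous f := Real.continuous_sqrt
  have hhc : Continuous h := by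
    exact Real.continuous_sqrt.div (by fun_prop) hne
  have hkc : Continuous k := hfc.mul hhc
  set r := cfcₙ f s with hr
  set g := cfcₙ h s with hg
  have hrs : star r = r := (IsSelfAdjoint.cfcₙ (f := f) (a := s)).star_eq
  have hgs : star g = g := (IsSelfAdjoint.cfcₙ (f := h) (a := s)).star_eq
  have hrr : r * r = s := by
    rw [hr, ← cfcₙ_mul f f s hfc.continuousOn (by simp [hf]) hfc.continuousOn (by simp [hf])]
    conv_rhs => rw [← cfcₙ_id' ℝ s]
    exact cfcₙ_congr fun t ht => Real.mul_self_sqrt (hq t ht)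
  have hrg : r * g = cfcₙ k s :=
    (cfcₙ_mul f h s hfc.continuousOn (by simp [hf]) hhc.continuousOn (by simp [hh])).symm
  set e := cfcₙ k s with he
  have hes : star e = e := (IsSelfAdjoint.cfcₙ (f := k) (a := s)).star_eq
  have hk0 : k 0 = 0 := by simp [hk]
  have hh0 : h 0 = 0 := by simp [hh]
  have hid : cfcₙ (fun t : ℝ => t) s = s := cfcₙ_id' ℝ s
  have hgsg : ‖g * s * g‖ ≤ 1 := by
    have : g * s * g = cfcₙ (fun t => h t * t * h t) s := by
      rw [cfcₙ_mul (fun t => h t * t) h s (by fun_prop) (by simp) (by fun_prop) hh0,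
        cfcₙ_mul h (fun t => t) s (by fun_prop) hh0 (by fun_prop) rfl, hid]
    rw [this]
    refine norm_cfcₙ_le fun t ht => ?_
    have ht0 := hq t ht
    have h1 : h t * t * h t = (t / (t + δ)) ^ 2 := by
      simp only [hh, abs_of_nonneg ht0]
      have : √t * √t = t := Real.mul_self_sqrt ht0
      field_simp
      rw [Real.sq_sqrt ht0]
      ring
    rw [h1, Real.norm_of_nonneg (by positivity)]
    have : t / (t + δ) ≤ 1 := (div_le_one (by positivity)).2 (by linarith)
    exact pow_le_one₀ (by positivity) this
  -- This is (1 - e)s(1 - e) written without a unit; on the spectrum it is tδ²/(t + δ)² ≤ δ.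
  have hdiff : ‖s - e * s - s * e + e * s * e‖ ≤ δ := by
    have : s - e * s - s * e + e * s * e
        = cfcₙ (fun t => t - k t * t - t * k t + k t * t * k t) s := by
      rw [cfcₙ_add (fun t => t - k t * t - t * k t) (fun t => k t * t * k t) s (by fun_prop)
          (by simp [hk0]) (by fun_prop) (by simp [hk0]),
        cfcₙ_sub (fun t => t - k t * t) (fun t => t * k t) s (by fun_prop) (by simp [hk0])
          (by fun_prop) (by simp),
        cfcₙ_sub (fun t => t) (fun t => k t * t) s (by fun_prop) (by simp)
          (by fun_prop) (by simp),
        cfcₙ_mul (fun t => k t * t) k s (by fun_prop) (by simp) (by fun_prop) hk0,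
        cfcₙ_mul k (fun t => t) s (by fun_prop) hk0 (by fun_prop) rfl,
        cfcₙ_mul (fun t => t) k s (by fun_prop) rfl (by fun_prop) hk0, hid]
    rw [this]
    refine norm_cfcₙ_le fun t ht => ?_
    have ht0 := hq t ht
    have h1 : t - k t * t - t * k t + k t * t * k t = t * δ ^ 2 / (t + δ) ^ 2 := by
      have hk1 : k t = t / (t + δ) := by
        simp only [hk, abs_of_nonneg ht0]
        rw [← mul_div_assoc, Real.mul_self_sqrt ht0]
      rw [hk1]
      have : t + δ ≠ 0 := by positivity
      field_simp
      ring
    rw [h1, Real.norm_of_nonneg (by positivity), div_le_iff₀ (by positivity)]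
    nlinarith [mul_nonneg ht0 hδ.le, mul_nonneg (sq_nonneg t) hδ.le, pow_pos hδ 3]
  have hpos : ∀ a : A, (r * (g * a) - a) * star (r * (g * a) - a)
      = a * star a - e * (a * star a) - a * star a * e + e * (a * star a) * e := fun a => by
    rw [← mul_assoc, hrg, star_sub, star_mul, hes]
    noncomm_ring
  have hsum : (r * (g * a₁) - a₁) * star (r * (g * a₁) - a₁)
      + (r * (g * a₂) - a₂) * star (r * (g * a₂) - a₂) = s - e * s - s * e + e * s * e := by
    rw [hpos, hpos, hs]
    noncomm_ring
  have hest : ∀ x y : A, ‖x * star x + y * star y‖ ≤ δ → ‖x‖ ≤ ε := fun x y hxy => by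
    have h1 : ‖x * star x‖ ≤ ‖x * star x + y * star y‖ :=
      CStarAlgebra.norm_le_norm_of_nonneg_of_le (mul_star_self_nonneg x)
        (le_add_of_nonneg_right (mul_star_self_nonneg y))
    rw [CStarRing.norm_self_mul_star] at h1
    refine le_of_sq_le_sq ?_ hε.le
    nlinarith
  refine ⟨r, g * a₁, g * a₂, hrs, hrr, ?_, hest _ (r * (g * a₂) - a₂) ?_,
    hest _ (r * (g * a₁) - a₁) ?_⟩
  · have : g * a₁ * star (g * a₁) + g * a₂ * star (g * a₂) = g * s * g := by
      rw [hs, star_mul, star_mul, hgs]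
      noncomm_ring
    rwa [this]
  · rwa [hsum]
  · rwa [add_comm, hsum]

end CStarAlgebraFactorization

/-! ### Weak* continuous maps: preadjoints and boundedness -/

section WeakStarContinuousMaps

open Filter Topology

variable {V : Type*} [NormedAddCommGroup V] [NormedSpace ℂ V]

/-- The preadjoint of `T`. The weak topology is coarser than the norm topology, so `F ∘ T` is
bounded as well as weakly continuous, and hence lies in `P`. -/
theorem exists_mem_eq_comp_of_continuous_weakTopologyOf {P : Submodule ℂ (StrongDual ℂ V)}
    (T : V →ₗ[ℂ] V)
    (hT : @Continuous V V (weakTopologyOf (P : Set (StrongDual ℂ V)))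
      (weakTopologyOf (P : Set (StrongDual ℂ V))) T) (F : StrongDual ℂ V) (hF : F ∈ P) :
    ∃ G ∈ P, ∀ v, G v = F (T v) := by
  have hle : (inferInstance : TopologicalSpace V) ≤ weakTopologyOf (P : Set (StrongDual ℂ V)) :=
    continuous_iff_le_induced.1 (continuous_pi fun G => G.1.continuous)
  have hFc : @Continuous V ℂ (weakTopologyOf (P : Set (StrongDual ℂ V))) _ F := by
    let _ : TopologicalSpace V := weakTopologyOf (P : Set (StrongDual ℂ V))
    have h1 : Continuous (fun (x : V) (G : P) => G.1 x : V → P → ℂ) := continuous_induced_dom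
    exact (continuous_apply (⟨F, hF⟩ : P)).comp h1
  have hc := @Continuous.comp V V ℂ (weakTopologyOf (P : Set (StrongDual ℂ V)))
    (weakTopologyOf (P : Set (StrongDual ℂ V))) _ _ _ hFc hT
  let G : StrongDual ℂ V := ⟨(F : V →ₗ[ℂ] ℂ) ∘ₗ T, continuous_le_dom hle hc⟩
  exact ⟨G, mem_of_continuous_weakTopologyOf G hc, fun v => rfl⟩

/-- Uniform boundedness on `Q`, for the functionals `q ↦ i q (T v) / ‖v‖`: at each `q` they are
bounded by the norm of `G`. -/
theorem exists_bound_of_comp_bounded {Q : Type*} [NormedAddCommGroup Q] [NormedSpace ℂ Q]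
    [CompleteSpace Q] (i : Q →ₗᵢ[ℂ] StrongDual ℂ V) (T : V → V)
    (h : ∀ q, ∃ G : StrongDual ℂ V, ∀ v, G v = i q (T v)) :
    ∃ C, ∀ q v, ‖i q (T v)‖ ≤ C * ‖v‖ * ‖q‖ := by
  let g : V → Q →L[ℂ] ℂ := fun v =>
    ((‖v‖⁻¹ : ℝ) : ℂ) • (ContinuousLinearMap.apply ℂ ℂ (T v)) ∘L i.toContinuousLinearMap
  have hg : ∀ v q, ‖g v q‖ = ‖v‖⁻¹ * ‖i q (T v)‖ := fun v q => by
    have : g v q = ((‖v‖⁻¹ : ℝ) : ℂ) * i q (T v) := rfl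
    rw [this, norm_mul, Complex.norm_real, norm_inv, norm_norm]
  obtain ⟨C, hC⟩ := banach_steinhaus (g := g) fun q => by
    obtain ⟨G, hG⟩ := h q
    refine ⟨‖G‖, fun v => ?_⟩
    rw [hg, inv_mul_eq_div, ← hG]
    exact div_le_of_le_mul₀ (norm_nonneg _) (norm_nonneg _) (G.le_opNorm v)
  refine ⟨C, fun q v => ?_⟩
  rcases eq_or_ne v 0 with rfl | hv
  · obtain ⟨G, hG⟩ := h q
    simp [← hG]
  have h1 := (g v).le_of_opNorm_le (hC v) q
  rw [hg, inv_mul_le_iff₀ (norm_pos_iff.2 hv)] at h1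
  linarith

/-- A weak* continuous linear map is bounded. -/
theorem exists_bound_of_continuous_weakTopologyOf {P : Submodule ℂ (StrongDual ℂ V)}
    (hP : IsPredual P) (T : V →ₗ[ℂ] V)
    (hT : @Continuous V V (weakTopologyOf (P : Set (StrongDual ℂ V)))
      (weakTopologyOf (P : Set (StrongDual ℂ V))) T) : ∃ C, ∀ v, ‖T v‖ ≤ C * ‖v‖ := by
  have : CompleteSpace P := hP.isClosed.completeSpace_coe
  obtain ⟨C, hC⟩ := exists_bound_of_comp_bounded (Q := P) P.subtypeₗᵢ T fun F => by
    obtain ⟨G, -, hG⟩ := exists_mem_eq_comp_of_continuous_weakTopologyOf T hT F F.2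
    exact ⟨G, hG⟩
  refine ⟨|C|, fun v => (hP.isometry (T v)).2 ?_⟩
  rintro _ ⟨F, hF, hF1, rfl⟩
  calc ‖F (T v)‖ ≤ C * ‖v‖ * ‖F‖ := hC ⟨F, hF⟩ v
    _ ≤ |C| * ‖v‖ * 1 := by gcongr; exact le_abs_self C
    _ = |C| * ‖v‖ := mul_one _

theorem tendsto_of_tendsto_on_dense {ι : Type*} {l : Filter ι} (T : ι → V →ₗ[ℂ] V)
    (hT : ∀ᶠ i in l, ∀ v, ‖T i v‖ ≤ ‖v‖) {D : Submodule ℂ V} (hD : D.topologicalClosure = ⊤)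
    (h : ∀ v ∈ D, Tendsto (fun i => T i v) l (𝓝 v)) (v : V) :
    Tendsto (fun i => T i v) l (𝓝 v) := by
  have hd : Dense (D : Set V) := Submodule.dense_iff_topologicalClosure_eq_top.2 hD
  rw [Metric.tendsto_nhds]
  intro ε hε
  obtain ⟨w, hw, hvw⟩ := Metric.dense_iff.1 hd v (ε / 3) (by positivity)
  rw [Metric.mem_ball, dist_eq_norm] at hw
  filter_upwards [hT, Metric.tendsto_nhds.1 (h w hvw) (ε / 3) (by positivity)] with i h1 h2
  rw [dist_eq_norm] at h2 ⊢
  calc ‖T i v - v‖ = ‖-T i (w - v) + (T i w - w) + (w - v)‖ := by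
        rw [map_sub]; congr 1; abel
    _ ≤ ‖T i (w - v)‖ + ‖T i w - w‖ + ‖w - v‖ := by
        refine (norm_add_le _ _).trans ?_
        gcongr
        refine (norm_add_le _ _).trans ?_
        rw [norm_neg]
    _ < ε := by linarith [h1 (w - v)]

end WeakStarContinuousMaps

/-! ### Contractivity of the actions and approximate units -/

section Actions

open Filter Topology

namespace CStarBimodule

variable {A B V : Type*} [NonUnitalCStarAlgebra A] [NonUnitalCStarAlgebra B]
  [NormedAddCommGroup V] [NormedSpace ℂ V] {M : CStarBimodule A B V}

theorem PropertyR.norm_lact_ract_le (hM : M.PropertyR) (a : A) (b : B) (v : V) :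
    ‖M.lact a (M.ract b v)‖ ≤ ‖a‖ * ‖b‖ * ‖v‖ := by
  rcases eq_or_ne v 0 with rfl | hv
  · simp
  have hv' : 0 < ‖v‖ := norm_pos_iff.2 hv
  have h := hM a 0 b 0 (((‖v‖⁻¹ : ℝ) : ℂ) • v) 0
    (by rw [norm_smul, Complex.norm_real, norm_inv, norm_norm, inv_mul_cancel₀ hv'.ne'])
    (by simp)
  simp only [map_smul, LinearMap.map_zero, add_zero, star_zero, mul_zero,
    CStarRing.norm_self_mul_star, CStarRing.norm_star_mul_self,
    Real.sqrt_mul_self (norm_nonneg _), norm_smul, Complex.norm_real, norm_inv, norm_norm] at h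
  rwa [inv_mul_le_iff₀ hv', mul_comm] at h

/-- Condition (R) only controls two-sided products `a v b`. Inserting an approximate unit of `B`
gives the sharp bound on the span of `VB`; the qualitative bound `hc` serves to pass to the closure.
-/
theorem IsRepresentable.norm_lact_le (hM : M.IsRepresentable) (a : A)
    (hc : ∃ C, ∀ v, ‖M.lact a v‖ ≤ C * ‖v‖) (v : V) : ‖M.lact a v‖ ≤ ‖a‖ * ‖v‖ := by
  let _ : PartialOrder B := CStarAlgebra.spectralOrder B
  have _ : StarOrderedRing B := CStarAlgebra.spectralOrderedRing B
  have hl := CStarAlgebra.increasingApproximateUnit B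
  have hcont : Continuous (M.lact a) := by
    obtain ⟨C, hC⟩ := hc
    exact ((M.lact a).mkContinuous C hC).continuous
  have hd := Submodule.dense_iff_topologicalClosure_eq_top.2 hM.essential.right
  refine hd.induction (P := fun v => ‖M.lact a v‖ ≤ ‖a‖ * ‖v‖) (fun v hv => ?_)
    (isClosed_le hcont.norm (by fun_prop)) v
  have ht : Tendsto (fun f => M.lact a (M.ract f v)) (CStarAlgebra.approximateUnit B)
      (𝓝 (M.lact a v)) := by
    induction hv using Submodule.span_induction with
    | mem x hx =>
      obtain ⟨b, w, rfl⟩ := hx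
      rw [tendsto_iff_norm_sub_tendsto_zero]
      have h1 := tendsto_iff_norm_sub_tendsto_zero.1 (hl.tendsto_mul_left b)
      have h2 : Tendsto (fun f => ‖a‖ * ‖b * f - b‖ * ‖w‖) (CStarAlgebra.approximateUnit B)
          (𝓝 0) := by simpa using (h1.const_mul ‖a‖).mul_const ‖w‖
      refine squeeze_zero (fun _ => norm_nonneg _) (fun f => ?_) h2
      rw [← M.ract_mul, ← map_sub, ← LinearMap.sub_apply, ← map_sub]
      exact hM.propertyR.norm_lact_ract_le _ _ _
    | zero => simp
    | add x y _ _ hx hy => simpa using hx.add hy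
    | smul c x _ hx => simpa using hx.const_smul c
  refine le_of_tendsto ht.norm ?_
  filter_upwards [hl.eventually_norm] with f hf
  refine (hM.propertyR.norm_lact_ract_le _ _ _).trans ?_
  gcongr
  exact mul_le_of_le_one_right (norm_nonneg _) hf

theorem IsRepresentable.norm_ract_le (hM : M.IsRepresentable) (b : B)
    (hc : ∃ C, ∀ v, ‖M.ract b v‖ ≤ C * ‖v‖) (v : V) : ‖M.ract b v‖ ≤ ‖b‖ * ‖v‖ := by
  let _ : PartialOrder A := CStarAlgebra.spectralOrder A
  have _ : StarOrderedRing A := CStarAlgebra.spectralOrderedRing A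
  have hl := CStarAlgebra.increasingApproximateUnit A
  have hcont : Continuous (M.ract b) := by
    obtain ⟨C, hC⟩ := hc
    exact ((M.ract b).mkContinuous C hC).continuous
  have hd := Submodule.dense_iff_topologicalClosure_eq_top.2 hM.essential.left
  refine hd.induction (P := fun v => ‖M.ract b v‖ ≤ ‖b‖ * ‖v‖) (fun v hv => ?_)
    (isClosed_le hcont.norm (by fun_prop)) v
  have ht : Tendsto (fun e => M.lact e (M.ract b v)) (CStarAlgebra.approximateUnit A)
      (𝓝 (M.ract b v)) := by
    induction hv using Submodule.span_induction with
    | mem x hx =>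
      obtain ⟨a, w, rfl⟩ := hx
      rw [tendsto_iff_norm_sub_tendsto_zero]
      have h1 := tendsto_iff_norm_sub_tendsto_zero.1 (hl.tendsto_mul_right a)
      have h2 : Tendsto (fun e => ‖e * a - a‖ * ‖b‖ * ‖w‖) (CStarAlgebra.approximateUnit A)
          (𝓝 0) := by simpa using (h1.mul_const ‖b‖).mul_const ‖w‖
      refine squeeze_zero (fun _ => norm_nonneg _) (fun e => ?_) h2
      rw [← M.lact_ract, ← M.lact_mul, ← LinearMap.sub_apply, ← map_sub]
      exact hM.propertyR.norm_lact_ract_le _ _ _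
    | zero => simp
    | add x y _ _ hx hy => simpa using hx.add hy
    | smul c x _ hx => simpa using hx.const_smul c
  refine le_of_tendsto ht.norm ?_
  filter_upwards [hl.eventually_norm] with e he
  refine (hM.propertyR.norm_lact_ract_le _ _ _).trans ?_
  gcongr
  exact mul_le_of_le_one_left (norm_nonneg _) he

variable {PV : Submodule ℂ (StrongDual ℂ V)}

theorem IsDualRepresentable.norm_lact_le (hM : M.IsDualRepresentable PV) (a : A) (v : V) :
    ‖M.lact a v‖ ≤ ‖a‖ * ‖v‖ :=
  hM.representable.norm_lact_le a
    (exists_bound_of_continuous_weakTopologyOf hM.isPredual _ (hM.continuous_lact a)) v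

theorem IsDualRepresentable.norm_ract_le (hM : M.IsDualRepresentable PV) (b : B) (v : V) :
    ‖M.ract b v‖ ≤ ‖b‖ * ‖v‖ :=
  hM.representable.norm_ract_le b
    (exists_bound_of_continuous_weakTopologyOf hM.isPredual _ (hM.continuous_ract b)) v

/-- For `F ∈ V_*`, the functional `v ↦ F(avb)` belongs to `V_*`. -/
theorem IsDualRepresentable.exists_mem_eq_lact_ract (hM : M.IsDualRepresentable PV)
    {F : StrongDual ℂ V} (hF : F ∈ PV) (a : A) (b : B) :
    ∃ G ∈ PV, ∀ v, G v = F (M.lact a (M.ract b v)) := by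
  obtain ⟨G, hG, h⟩ := exists_mem_eq_comp_of_continuous_weakTopologyOf _ (hM.continuous_lact a) F hF
  obtain ⟨G', hG', h'⟩ :=
    exists_mem_eq_comp_of_continuous_weakTopologyOf _ (hM.continuous_ract b) G hG
  exact ⟨G', hG', fun v => by rw [h', h]⟩

theorem IsDualRepresentable.tendsto_lact (hM : M.IsDualRepresentable PV) [PartialOrder A]
    [StarOrderedRing A] (v : V) :
    Tendsto (fun e => M.lact e v) (CStarAlgebra.approximateUnit A) (𝓝 v) := by
  have hl := CStarAlgebra.increasingApproximateUnit A
  refine tendsto_of_tendsto_on_dense (fun e => M.lact e) ?_ hM.representable.essential.left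
    (fun v hv => ?_) v
  · filter_upwards [hl.eventually_norm] with e he v
    exact (hM.norm_lact_le e v).trans (mul_le_of_le_one_left (norm_nonneg _) he)
  · induction hv using Submodule.span_induction with
    | mem x hx =>
      obtain ⟨a, w, rfl⟩ := hx
      rw [tendsto_iff_norm_sub_tendsto_zero]
      have h1 := tendsto_iff_norm_sub_tendsto_zero.1 (hl.tendsto_mul_right a)
      refine squeeze_zero (fun _ => norm_nonneg _) (fun e => ?_)
        (by simpa using h1.mul_const ‖w‖)
      rw [← M.lact_mul, ← LinearMap.sub_apply, ← map_sub]
      exact hM.norm_lact_le _ _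
    | zero => simp
    | add x y _ _ hx hy => simpa using hx.add hy
    | smul c x _ hx => simpa using hx.const_smul c

theorem IsDualRepresentable.tendsto_ract (hM : M.IsDualRepresentable PV) [PartialOrder B]
    [StarOrderedRing B] (v : V) :
    Tendsto (fun f => M.ract f v) (CStarAlgebra.approximateUnit B) (𝓝 v) := by
  have hl := CStarAlgebra.increasingApproximateUnit B
  refine tendsto_of_tendsto_on_dense (fun f => M.ract f) ?_ hM.representable.essential.right
    (fun v hv => ?_) v
  · filter_upwards [hl.eventually_norm] with f hf v
    exact (hM.norm_ract_le f v).trans (mul_le_of_le_one_left (norm_nonneg _) hf)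
  · induction hv using Submodule.span_induction with
    | mem x hx =>
      obtain ⟨b, w, rfl⟩ := hx
      rw [tendsto_iff_norm_sub_tendsto_zero]
      have h1 := tendsto_iff_norm_sub_tendsto_zero.1 (hl.tendsto_mul_left b)
      refine squeeze_zero (fun _ => norm_nonneg _) (fun f => ?_)
        (by simpa using h1.mul_const ‖w‖)
      rw [← M.ract_mul, ← LinearMap.sub_apply, ← map_sub]
      exact hM.norm_ract_le _ _
    | zero => simp
    | add x y _ _ hx hy => simpa using hx.add hy
    | smul c x _ hx => simpa using hx.const_smul c

/-- `v` is an iterated norm limit of `e v f` along contractive approximate units of `A` and `B`. -/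
theorem IsDualRepresentable.norm_apply_le_of_lact_ract (hM : M.IsDualRepresentable PV)
    (F : StrongDual ℂ V) (v : V) {C : ℝ}
    (h : ∀ a b, ‖a‖ ≤ 1 → ‖b‖ ≤ 1 → ‖F (M.lact a (M.ract b v))‖ ≤ C) : ‖F v‖ ≤ C := by
  let _ : PartialOrder A := CStarAlgebra.spectralOrder A
  have _ : StarOrderedRing A := CStarAlgebra.spectralOrderedRing A
  let _ : PartialOrder B := CStarAlgebra.spectralOrder B
  have _ : StarOrderedRing B := CStarAlgebra.spectralOrderedRing B
  refine le_of_tendsto ((F.continuous.tendsto _).comp (hM.tendsto_ract v)).norm ?_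
  filter_upwards [(CStarAlgebra.increasingApproximateUnit B).eventually_norm] with b hb
  refine le_of_tendsto ((F.continuous.tendsto _).comp (hM.tendsto_lact (M.ract b v))).norm ?_
  filter_upwards [(CStarAlgebra.increasingApproximateUnit A).eventually_norm] with a ha
  exact h a b ha hb

end CStarBimodule

end Actions

/-! ### Dominating positive functionals from Hahn–Banach -/

section PositiveFunctionals

open scoped ComplexOrder

/-- With x = s² the hypothesis says that px² - 2zx + q is nonnegative for x > 0; for x ≤ 0 this is
clear, so the discriminant is nonpositive. -/
theorem exists_le_of_forall_mul_le {z p q : ℝ} (hz : 0 ≤ z) (hp : 0 ≤ p) (hq : 0 ≤ q)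
    (h : ∀ s : ℝ, 0 < s → 2 * z ≤ s ^ 2 * p + (s⁻¹) ^ 2 * q) : z ≤ √p * √q := by
  rw [← Real.sqrt_mul hp]
  refine Real.le_sqrt_of_sq_le ?_
  have h1 : ∀ x : ℝ, 0 ≤ p * (x * x) + (-(2 * z)) * x + q := fun x => by
    rcases le_or_gt x 0 with hx | hx
    · nlinarith [mul_nonneg hp (mul_self_nonneg x), mul_nonneg hz (neg_nonneg.2 hx)]
    · have h2 := h (√x) (Real.sqrt_pos.2 hx)
      rw [inv_pow, Real.sq_sqrt hx.le] at h2
      have h3 : x * (2 * z) ≤ x * (x * p + x⁻¹ * q) := mul_le_mul_of_nonneg_left h2 hx.le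
      have h4 : x * (x * p + x⁻¹ * q) = p * (x * x) + q := by field_simp
      linarith
  have := discrim_le_zero h1
  rw [discrim] at this
  nlinarith

/-- A real functional on a C*-algebra which is positive on positive elements agrees there with a
positive complex linear functional. -/
theorem exists_positiveLinearMap_of_real {A : Type*} [NonUnitalCStarAlgebra A] [PartialOrder A]
    [StarOrderedRing A] (φ : A →ₗ[ℝ] ℝ) (hφ : ∀ x, 0 ≤ x → 0 ≤ φ x) :
    ∃ f : A →ₚ[ℂ] ℂ, ∀ x, 0 ≤ x → f x = φ x := by
  -- Passing through the real part discards whatever `φ` does on skew-adjoint elements, so the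
  -- complexification has no imaginary part on positive elements.
  let fr : Module.Dual ℝ A := φ ∘ₗ (selfAdjoint.submodule ℝ A).subtype ∘ₗ realPart
  have key : ∀ x : A, 0 ≤ x → (fr.extendRCLike : A →ₗ[ℂ] ℂ) x = φ x := fun x hx => by
    have hsa : IsSelfAdjoint x := .of_nonneg hx
    have h1 : fr x = φ x := by
      change φ (realPart x : A) = φ x
      rw [hsa.coe_realPart]
    have h2 : fr (Complex.I • x) = 0 := by
      change φ (realPart (Complex.I • x) : A) = 0
      rw [realPart_I_smul, hsa.imaginaryPart]
      simp
    rw [Module.Dual.extendRCLike_apply]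
    have h3 : (RCLike.I : ℂ) = Complex.I := rfl
    rw [h3, h1, h2]
    simp
  refine ⟨PositiveLinearMap.mk₀ fr.extendRCLike fun x hx => ?_, key⟩
  rw [key x hx]
  exact_mod_cast hφ x hx

namespace CStarBimodule

variable {A B V : Type*} [NonUnitalCStarAlgebra A] [NonUnitalCStarAlgebra B]
  [NormedAddCommGroup V] [NormedSpace ℂ V] {M : CStarBimodule A B V}

/-- Factor the row (a₁, a₂) as r(c₁, c₂) and the column of the bᵢ as (dᵢ*)t, with contractive row
and column. Then v = c₁v₁d₁* + c₂v₂d₂* has norm at most 1 by condition (R), and rvt approximates the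
sum. -/
theorem PropertyR.exists_combination (hM : M.PropertyR) (a₁ a₂ : A) (b₁ b₂ : B) {v₁ v₂ : V}
    (hv₁ : ‖v₁‖ ≤ 1) (hv₂ : ‖v₂‖ ≤ 1) {ε : ℝ} (hε : 0 < ε) :
    ∃ (a : A) (b : B) (v : V), ‖v‖ ≤ 1 ∧ a * star a = a₁ * star a₁ + a₂ * star a₂ ∧
      star b * b = star b₁ * b₁ + star b₂ * b₂ ∧
      ‖M.lact a (M.ract b v) - (M.lact a₁ (M.ract b₁ v₁) + M.lact a₂ (M.ract b₂ v₂))‖ ≤ ε := by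
  set N := ‖a₁‖ + ‖a₂‖ + ‖b₁‖ + ‖b₂‖ + 1 with hN
  have ha₁ := norm_nonneg a₁
  have ha₂ := norm_nonneg a₂
  have hb₁ := norm_nonneg b₁
  have hb₂ := norm_nonneg b₂
  have hN1 : 1 ≤ N := by linarith
  -- Each of the two summands may cost ε/2, bounded by δN; δ ≤ 1 keeps `star d * t` within norm `‖b‖
  -- + 1`.
  set δ := min 1 (ε / (2 * N)) with hδ
  have hδ0 : 0 < δ := lt_min one_pos (by positivity)
  have hδ1 : δ ≤ 1 := min_le_left _ _
  have hδN : δ * N ≤ ε / 2 := by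
    have : δ ≤ ε / (2 * N) := min_le_right _ _
    rw [le_div_iff₀ (by positivity)] at this
    linarith
  obtain ⟨r, c₁, c₂, hr, hrr, hc, hc₁, hc₂⟩ := exists_row_factorization a₁ a₂ hδ0
  obtain ⟨t, d₁, d₂, ht, htt, hd, hd₁, hd₂⟩ := exists_row_factorization (star b₁) (star b₂) hδ0
  have hstar : ∀ (d b : B), ‖t * d - star b‖ ≤ δ → ‖star d * t - b‖ ≤ δ := fun d b h => by
    rw [← norm_star, star_sub, star_mul, star_star, ht]
    exact h
  have key : ∀ (c a : A) (d b : B) (v : V), ‖v‖ ≤ 1 → ‖r * c - a‖ ≤ δ → ‖star d * t - b‖ ≤ δ →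
      ‖a‖ + ‖b‖ + 1 ≤ N →
      ‖M.lact r (M.ract t (M.lact c (M.ract (star d) v))) - M.lact a (M.ract b v)‖ ≤ ε / 2 := by
    intro c a d b v hv h1 h2 h3
    have h4 : M.lact r (M.ract t (M.lact c (M.ract (star d) v))) - M.lact a (M.ract b v)
        = M.lact (r * c - a) (M.ract (star d * t) v) + M.lact a (M.ract (star d * t - b) v) := by
      rw [← M.lact_ract c t, ← M.lact_mul, ← M.ract_mul]
      simp
    have h5 : ‖star d * t‖ ≤ ‖b‖ + δ := by
      have := norm_add_le (star d * t - b) b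
      rw [sub_add_cancel] at this
      linarith
    calc _ ≤ ‖r * c - a‖ * ‖star d * t‖ * ‖v‖ + ‖a‖ * ‖star d * t - b‖ * ‖v‖ := by
          rw [h4]
          exact (norm_add_le _ _).trans
            (add_le_add (hM.norm_lact_ract_le _ _ _) (hM.norm_lact_ract_le _ _ _))
      _ ≤ δ * (‖b‖ + 1) * 1 + ‖a‖ * δ * 1 := by gcongr; linarith
      _ = δ * (‖a‖ + ‖b‖ + 1) := by ring
      _ ≤ δ * N := by gcongr
      _ ≤ ε / 2 := hδN
  refine ⟨r, t, M.lact c₁ (M.ract (star d₁) v₁) + M.lact c₂ (M.ract (star d₂) v₂), ?_, ?_, ?_, ?_⟩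
  · refine (hM c₁ c₂ (star d₁) (star d₂) v₁ v₂ hv₁ hv₂).trans ?_
    rw [star_star, star_star]
    exact mul_le_one₀ (Real.sqrt_le_one.2 hc) (Real.sqrt_nonneg _) (Real.sqrt_le_one.2 hd)
  · rw [hr, hrr]
  · rw [ht, htt, star_star, star_star]
  · have h1 := key c₁ a₁ d₁ b₁ v₁ hv₁ hc₁ (hstar _ _ hd₁) (by linarith)
    have h2 := key c₂ a₂ d₂ b₂ v₂ hv₂ hc₂ (hstar _ _ hd₂) (by linarith)
    rw [map_add, map_add, add_sub_add_comm]
    exact (norm_add_le _ _).trans (by linarith)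

/-- The infimum over `a`, `b` and `‖v‖ ≤ 1` of
`‖x + a a^*‖ + ‖y + b^* b‖ - 2 Re F(avb)`. -/
noncomputable def gaugeOf (M : CStarBimodule A B V) (F : StrongDual ℂ V) (z : A × B) : ℝ :=
  ⨅ t : A × B × {v : V // ‖v‖ ≤ 1}, (‖z.1 + t.1 * star t.1‖ + ‖z.2 + star t.2.1 * t.2.1‖
    - 2 * (F (M.lact t.1 (M.ract t.2.1 t.2.2))).re)

theorem PropertyR.re_apply_le (hM : M.PropertyR) {F : StrongDual ℂ V} (hF : ‖F‖ ≤ 1) (a : A)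
    (b : B) {v : V} (hv : ‖v‖ ≤ 1) : (F (M.lact a (M.ract b v))).re ≤ ‖a‖ * ‖b‖ := by
  refine (Complex.re_le_norm _).trans ((F.le_of_opNorm_le hF _).trans ?_)
  rw [one_mul]
  exact (hM.norm_lact_ract_le a b v).trans (mul_le_of_le_one_right (by positivity) hv)

/-- Since 2‖a‖‖b‖ ≤ ‖a‖² + ‖b‖², the terms are bounded below, so the real infimum in `gaugeOf` is a
genuine one. -/
theorem PropertyR.le_gauge_term (hM : M.PropertyR) {F : StrongDual ℂ V} (hF : ‖F‖ ≤ 1) (z : A × B)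
    (a : A) (b : B) {v : V} (hv : ‖v‖ ≤ 1) :
    -(‖z.1‖ + ‖z.2‖) ≤ ‖z.1 + a * star a‖ + ‖z.2 + star b * b‖
      - 2 * (F (M.lact a (M.ract b v))).re := by
  have h1 := hM.re_apply_le hF a b hv
  have h2 : ‖a‖ * ‖a‖ ≤ ‖z.1 + a * star a‖ + ‖z.1‖ := by
    rw [← CStarRing.norm_self_mul_star]
    simpa using norm_sub_le (z.1 + a * star a) z.1
  have h3 : ‖b‖ * ‖b‖ ≤ ‖z.2 + star b * b‖ + ‖z.2‖ := by
    rw [← CStarRing.norm_star_mul_self]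
    simpa using norm_sub_le (z.2 + star b * b) z.2
  nlinarith [sq_nonneg (‖a‖ - ‖b‖)]

theorem PropertyR.gaugeOf_le (hM : M.PropertyR) {F : StrongDual ℂ V} (hF : ‖F‖ ≤ 1) (z : A × B)
    (a : A) (b : B) {v : V} (hv : ‖v‖ ≤ 1) :
    M.gaugeOf F z ≤ ‖z.1 + a * star a‖ + ‖z.2 + star b * b‖
      - 2 * (F (M.lact a (M.ract b v))).re := by
  refine ciInf_le ⟨-(‖z.1‖ + ‖z.2‖), ?_⟩ ((a, b, ⟨v, hv⟩) : A × B × {v : V // ‖v‖ ≤ 1})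
  rintro _ ⟨t, rfl⟩
  exact hM.le_gauge_term hF z _ _ t.2.2.2

instance : Nonempty {v : V // ‖v‖ ≤ 1} := ⟨⟨0, by simp⟩⟩

theorem exists_lt_gaugeOf_add (M : CStarBimodule A B V) (F : StrongDual ℂ V) (z : A × B) {ε : ℝ}
    (hε : 0 < ε) : ∃ (a : A) (b : B) (v : V), ‖v‖ ≤ 1 ∧
      ‖z.1 + a * star a‖ + ‖z.2 + star b * b‖ - 2 * (F (M.lact a (M.ract b v))).re
        < M.gaugeOf F z + ε := by
  obtain ⟨t, ht⟩ := exists_lt_of_ciInf_lt (lt_add_of_pos_right (M.gaugeOf F z) hε)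
  exact ⟨t.1, t.2.1, t.2.2, t.2.2.2, ht⟩

theorem PropertyR.gaugeOf_add_le (hM : M.PropertyR) {F : StrongDual ℂ V} (hF : ‖F‖ ≤ 1)
    (z z' : A × B) : M.gaugeOf F (z + z') ≤ M.gaugeOf F z + M.gaugeOf F z' := by
  refine le_of_forall_pos_le_add fun ε hε => ?_
  obtain ⟨a₁, b₁, v₁, hv₁, h₁⟩ := M.exists_lt_gaugeOf_add F z (ε := ε / 4) (by positivity)
  obtain ⟨a₂, b₂, v₂, hv₂, h₂⟩ := M.exists_lt_gaugeOf_add F z' (ε := ε / 4) (by positivity)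
  obtain ⟨a, b, v, hv, ha, hb, h⟩ := hM.exists_combination a₁ a₂ b₁ b₂ hv₁ hv₂
    (ε := ε / 4) (by positivity)
  refine (hM.gaugeOf_le hF _ a b hv).trans ?_
  have h3 : ‖(z + z').1 + a * star a‖ ≤ ‖z.1 + a₁ * star a₁‖ + ‖z'.1 + a₂ * star a₂‖ := by
    rw [ha, Prod.fst_add, add_add_add_comm]
    exact norm_add_le _ _
  have h4 : ‖(z + z').2 + star b * b‖ ≤ ‖z.2 + star b₁ * b₁‖ + ‖z'.2 + star b₂ * b₂‖ := by
    rw [hb, Prod.snd_add, add_add_add_comm]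
    exact norm_add_le _ _
  have h5 := (Complex.abs_re_le_norm _).trans ((F.le_of_opNorm_le hF _).trans
    ((one_mul _).trans_le h))
  rw [map_sub, map_add, Complex.sub_re, Complex.add_re] at h5
  have h6 := (abs_le.1 h5).1
  linarith

/-- Replacing (a, b) by (√c a, √c b) multiplies `a * star a`, `star b * b` and F(avb) alike by c. -/
theorem PropertyR.gaugeOf_smul_le (hM : M.PropertyR) {F : StrongDual ℂ V} (hF : ‖F‖ ≤ 1)
    {c : ℝ} (hc : 0 < c) (z : A × B) : M.gaugeOf F (c • z) ≤ c * M.gaugeOf F z := by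
  refine le_of_forall_pos_le_add fun ε hε => ?_
  obtain ⟨a, b, v, hv, h⟩ := M.exists_lt_gaugeOf_add F z (ε := ε / c) (by positivity)
  have hs : (√c : ℂ) * (√c : ℂ) = (c : ℂ) := by
    rw [← Complex.ofReal_mul, Real.mul_self_sqrt hc.le]
  refine (hM.gaugeOf_le hF _ ((√c : ℂ) • a) ((√c : ℂ) • b) hv).trans ?_
  have h1 : (c • z).1 + ((√c : ℂ) • a) * star ((√c : ℂ) • a) = (c : ℂ) • (z.1 + a * star a) := by
    rw [star_smul, smul_mul_smul_comm, Complex.star_def, Complex.conj_ofReal, hs, smul_add]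
    rfl
  have h2 : (c • z).2 + star ((√c : ℂ) • b) * ((√c : ℂ) • b) = (c : ℂ) • (z.2 + star b * b) := by
    rw [star_smul, smul_mul_smul_comm, Complex.star_def, Complex.conj_ofReal, hs, smul_add]
    rfl
  have h3 : F (M.lact ((√c : ℂ) • a) (M.ract ((√c : ℂ) • b) v))
      = (c : ℂ) * F (M.lact a (M.ract b v)) := by
    simp only [map_smul, LinearMap.smul_apply, smul_eq_mul, ← mul_assoc, hs]
  rw [h1, h2, h3, norm_smul, norm_smul, Complex.norm_real, Real.norm_of_nonneg hc.le,
    Complex.re_ofReal_mul]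
  have h4 := mul_le_mul_of_nonneg_left h.le hc.le
  have h5 : c * (M.gaugeOf F z + ε / c) = c * M.gaugeOf F z + ε := by field_simp
  linarith

theorem PropertyR.gaugeOf_smul (hM : M.PropertyR) {F : StrongDual ℂ V} (hF : ‖F‖ ≤ 1)
    {c : ℝ} (hc : 0 < c) (z : A × B) : M.gaugeOf F (c • z) = c * M.gaugeOf F z := by
  refine le_antisymm (hM.gaugeOf_smul_le hF hc z) ?_
  have h := hM.gaugeOf_smul_le hF (inv_pos.2 hc) (c • z)
  rw [inv_smul_smul₀ hc.ne'] at h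
  calc c * M.gaugeOf F z ≤ c * (c⁻¹ * M.gaugeOf F (c • z)) := by gcongr
    _ = _ := by rw [mul_inv_cancel_left₀ hc.ne']

/-- Under condition (R), contractive functionals satisfy a Cauchy–Schwarz inequality with respect to
contractive positive functionals on `A` and `B`. -/
theorem PropertyR.exists_positiveLinearMap [PartialOrder A] [StarOrderedRing A] [PartialOrder B]
    [StarOrderedRing B] (hM : M.PropertyR) {F : StrongDual ℂ V} (hF : ‖F‖ ≤ 1) :
    ∃ (φ : A →ₚ[ℂ] ℂ) (ψ : B →ₚ[ℂ] ℂ), (∀ a, (φ (star a * a)).re ≤ ‖a‖ ^ 2) ∧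
      (∀ b, (ψ (star b * b)).re ≤ ‖b‖ ^ 2) ∧ ∀ a b v, ‖F (M.lact a (M.ract b v))‖ ≤
        ‖v‖ * √(φ (a * star a)).re * √(ψ (star b * b)).re := by
  -- Hahn–Banach from the zero subspace: only the domination of `g` by the gauge matters.
  obtain ⟨g, -, hg⟩ := exists_extension_of_le_sublinear (⊥ : (A × B) →ₗ.[ℝ] ℝ) (M.gaugeOf F)
    (fun c hc z => hM.gaugeOf_smul hF hc z) (hM.gaugeOf_add_le hF) (by
      rintro ⟨x, hx⟩
      have hx0 : x = 0 := hx
      subst hx0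
      have h := hM.gaugeOf_smul hF (c := 2) two_pos 0
      rw [smul_zero] at h
      have : M.gaugeOf F 0 = 0 := by linarith
      rw [this]
      exact le_of_eq (LinearPMap.map_zero _))
  have hg1 : ∀ x y, g (x, y) ≤ ‖x‖ + ‖y‖ := fun x y => by
    refine (hg _).trans ((hM.gaugeOf_le hF _ 0 0 (v := 0) (by simp)).trans ?_)
    simp
  -- At the point -(aa*, b*b), the same triple (a, b, v) makes both norms in the gauge vanish.
  have hg2 : ∀ a b v, ‖v‖ ≤ 1 →
      2 * (F (M.lact a (M.ract b v))).re ≤ g (a * star a, star b * b) := fun a b v hv => by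
    have h := (hg (-(a * star a, star b * b))).trans (hM.gaugeOf_le hF _ a b hv)
    simp only [map_neg, Prod.fst_neg, Prod.snd_neg, neg_add_cancel, norm_zero] at h
    linarith
  have hposA : ∀ x : A, 0 ≤ x → 0 ≤ g (x, 0) := fun x hx => by
    have h := hg2 (CFC.sqrt x) 0 0 (by simp)
    rw [(IsSelfAdjoint.of_nonneg (CFC.sqrt_nonneg x)).star_eq, CFC.sqrt_mul_sqrt_self x hx] at h
    simpa using h
  have hposB : ∀ y : B, 0 ≤ y → 0 ≤ g (0, y) := fun y hy => by
    have h := hg2 0 (CFC.sqrt y) 0 (by simp)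
    rw [(IsSelfAdjoint.of_nonneg (CFC.sqrt_nonneg y)).star_eq, CFC.sqrt_mul_sqrt_self y hy] at h
    simpa using h
  obtain ⟨φ, hφ⟩ := exists_positiveLinearMap_of_real (g ∘ₗ LinearMap.inl ℝ A B) hposA
  obtain ⟨ψ, hψ⟩ := exists_positiveLinearMap_of_real (g ∘ₗ LinearMap.inr ℝ A B) hposB
  have hφ' : ∀ x, 0 ≤ x → (φ x).re = g (x, 0) := fun x hx => by rw [hφ x hx]; rfl
  have hψ' : ∀ y, 0 ≤ y → (ψ y).re = g (0, y) := fun y hy => by rw [hψ y hy]; rfl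
  refine ⟨φ, ψ, fun a => ?_, fun b => ?_, ?_⟩
  · rw [hφ' _ (star_mul_self_nonneg a), sq, ← CStarRing.norm_star_mul_self]
    simpa using hg1 (star a * a) 0
  · rw [hψ' _ (star_mul_self_nonneg b), sq, ← CStarRing.norm_star_mul_self]
    simpa using hg1 0 (star b * b)
  have key : ∀ a b v, ‖v‖ ≤ 1 → ‖F (M.lact a (M.ract b v))‖ ≤
      √(φ (a * star a)).re * √(ψ (star b * b)).re := by
    intro a b v hv
    rw [hφ' _ (mul_star_self_nonneg a), hψ' _ (star_mul_self_nonneg b)]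
    refine exists_le_of_forall_mul_le (norm_nonneg _) (hposA _ (mul_star_self_nonneg a))
      (hposB _ (star_mul_self_nonneg b)) fun s hs => ?_
    -- The phase `c` replaces the real part by the modulus. The pair (sa, s⁻¹b) leaves F(avb)
    -- unchanged while scaling the two halves of `g` by s² and s⁻².
    obtain ⟨c, hc, hcF⟩ := RCLike.exists_norm_eq_mul_self (F (M.lact a (M.ract b v)))
    have h := hg2 ((s : ℂ) • a) (((s⁻¹ : ℝ) : ℂ) • b) (c • v) (by rwa [norm_smul, hc, one_mul])
    have h1 : F (M.lact ((s : ℂ) • a) (M.ract (((s⁻¹ : ℝ) : ℂ) • b) (c • v)))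
        = ((‖F (M.lact a (M.ract b v))‖ : ℝ) : ℂ) := by
      have hcF' : ((‖F (M.lact a (M.ract b v))‖ : ℝ) : ℂ) = c * F (M.lact a (M.ract b v)) := hcF
      have hs' : (s : ℂ) ≠ 0 := by exact_mod_cast hs.ne'
      simp only [map_smul, LinearMap.smul_apply, smul_eq_mul, hcF', Complex.ofReal_inv]
      field_simp
    have h2 : (((s : ℂ) • a) * star ((s : ℂ) • a), star (((s⁻¹ : ℝ) : ℂ) • b) * (((s⁻¹ : ℝ) : ℂ) • b))
        = s ^ 2 • (a * star a, (0 : B)) + (s⁻¹) ^ 2 • ((0 : A), star b * b) := by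
      simp only [star_smul, smul_mul_smul_comm, Complex.star_def, Complex.conj_ofReal,
        ← Complex.ofReal_mul, Prod.smul_mk, smul_zero, Prod.mk_add_mk, add_zero, zero_add, sq]
      rfl
    rw [h1, h2, Complex.ofReal_re, map_add, map_smul, map_smul, smul_eq_mul, smul_eq_mul] at h
    exact h
  intro a b v
  rcases eq_or_ne v 0 with rfl | hv
  · simp
  have hv' : 0 < ‖v‖ := norm_pos_iff.2 hv
  have h := key a b (((‖v‖⁻¹ : ℝ) : ℂ) • v)
    (by rw [norm_smul, Complex.norm_real, norm_inv, norm_norm, inv_mul_cancel₀ hv'.ne'])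
  simp only [map_smul, norm_smul, Complex.norm_real, norm_inv, norm_norm] at h
  rwa [inv_mul_le_iff₀ hv', ← mul_assoc] at h

end CStarBimodule

end PositiveFunctionals

/-! ### The GNS map of a positive functional -/

section GNS

open scoped ComplexOrder InnerProductSpace

namespace PositiveLinearMap

variable {A : Type*} [NonUnitalCStarAlgebra A] [PartialOrder A] [StarOrderedRing A]

/-- The canonical map of a C*-algebra into the GNS space of a positive functional. -/
noncomputable def gnsMap (f : A →ₚ[ℂ] ℂ) : A →ₗ[ℂ] f.GNS :=
  (UniformSpace.Completion.toComplL : f.PreGNS →L[ℂ] f.GNS).toLinearMap ∘ₗ f.toPreGNS.toLinearMap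

theorem gnsMap_apply (f : A →ₚ[ℂ] ℂ) (a : A) : f.gnsMap a = (f.toPreGNS a : f.GNS) := rfl

theorem denseRange_gnsMap (f : A →ₚ[ℂ] ℂ) : DenseRange f.gnsMap :=
  UniformSpace.Completion.denseRange_coe.comp f.toPreGNS.surjective.denseRange
    (UniformSpace.Completion.continuous_coe _)

theorem norm_gnsMap (f : A →ₚ[ℂ] ℂ) (a : A) : ‖f.gnsMap a‖ = √(f (star a * a)).re := by
  rw [gnsMap_apply, UniformSpace.Completion.norm_coe, preGNS_norm_def, ofPreGNS_toPreGNS]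

theorem gnsNonUnitalStarAlgHom_gnsMap (f : A →ₚ[ℂ] ℂ) (a x : A) :
    f.gnsNonUnitalStarAlgHom a (f.gnsMap x) = f.gnsMap (a * x) := by
  rw [gnsMap_apply, gnsNonUnitalStarAlgHom_apply_coe]
  rfl

end PositiveLinearMap

end GNS

/-! ### Hilbert sums of representations and operators -/

section DirectSum

open ContinuousLinearMap

variable {ι : Type*} {H K : ι → Type*} [∀ i, NormedAddCommGroup (H i)]
  [∀ i, InnerProductSpace ℂ (H i)] [∀ i, NormedAddCommGroup (K i)]
  [∀ i, InnerProductSpace ℂ (K i)]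

/-- The direct sum of a family of representations. -/
theorem exists_directSum_starAlgHom {A : Type*} [NonUnitalCStarAlgebra A]
    [∀ i, CompleteSpace (H i)] (π : ∀ i, A →⋆ₙₐ[ℂ] (H i →L[ℂ] H i)) :
    ∃ σ : A →⋆ₙₐ[ℂ] (lp H 2 →L[ℂ] lp H 2), ∀ a x i, σ a x i = π i a (x i) := by
  let T : A → (lp H 2 →L[ℂ] lp H 2) := fun a =>
    lp.mapCLM 2 (fun i => π i a) (norm_nonneg a) fun i => NonUnitalStarAlgHom.norm_apply_le _ a
  have hT : ∀ a x i, T a x i = π i a (x i) := fun a x i => rfl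
  refine ⟨{ toFun := T
            map_smul' := fun c a => ?_
            map_zero' := ?_
            map_add' := fun a b => ?_
            map_mul' := fun a b => ?_
            map_star' := fun a => ?_ }, hT⟩
  · ext x i
    simp [hT]
  · ext x i
    simp [hT]
  · ext x i
    simp [hT]
  · ext x i
    simp [hT]
  · refine (eq_adjoint_iff _ _).2 fun x y => ?_
    rw [lp.inner_eq_tsum, lp.inner_eq_tsum]
    refine tsum_congr fun i => ?_
    rw [hT, hT, map_star, star_eq_adjoint, adjoint_inner_left]

/-- The direct sum of a family of contractive operator valued linear maps. -/
theorem exists_directSum_clm {V : Type*} [NormedAddCommGroup V] [NormedSpace ℂ V]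
    (J : ∀ i, V →ₗ[ℂ] (K i →L[ℂ] H i)) (hJ : ∀ i v, ‖J i v‖ ≤ ‖v‖) :
    ∃ Φ : V →ₗ[ℂ] (lp K 2 →L[ℂ] lp H 2), (∀ v x i, Φ v x i = J i v (x i)) ∧ (∀ v, ‖Φ v‖ ≤ ‖v‖) ∧
      ∀ i v, ‖J i v‖ ≤ ‖Φ v‖ := by
  classical
  let T : V → (lp K 2 →L[ℂ] lp H 2) := fun v =>
    lp.mapCLM 2 (fun i => J i v) (norm_nonneg v) fun i => hJ i v
  have hT : ∀ v x i, T v x i = J i v (x i) := fun a x i => rfl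
  refine ⟨{ toFun := T
            map_smul' := fun c a => ?_
            map_add' := fun a b => ?_ }, hT, fun v =>
      lp.norm_mapCLM_le 2 (fun i => J i v) (norm_nonneg v) fun i => hJ i v, fun i v => ?_⟩
  · ext x i
    simp [hT]
  · ext x i
    simp [hT]
  · change ‖J i v‖ ≤ ‖T v‖
    refine opNorm_le_bound _ (norm_nonneg (T v)) fun ξ => ?_
    have h1 : J i v ξ = T v (lp.single 2 i ξ) i := by
      rw [hT, lp.single_apply_self]
    rw [h1]
    refine (lp.norm_apply_le_norm two_ne_zero _ i).trans ((le_opNorm _ _).trans ?_)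
    rw [lp.norm_single (by norm_num)]

theorem dense_span_lp_single [DecidableEq ι] (S : ∀ i, Set (H i))
    (hS : ∀ i, Dense (S i)) :
    Dense (Submodule.span ℂ {x : lp H 2 | ∃ i, ∃ y ∈ S i, x = lp.single 2 i y} : Set (lp H 2)) := by
  set L := (Submodule.span ℂ {x : lp H 2 | ∃ i, ∃ y ∈ S i, x = lp.single 2 i y}).topologicalClosure
    with hL
  have hLc : IsClosed (L : Set (lp H 2)) := Submodule.isClosed_topologicalClosure _
  have h1 : ∀ i y, lp.single 2 i y ∈ L := fun i y => by
    refine (hS i).induction (P := fun y => lp.single 2 i y ∈ L) (fun y hy => ?_)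
      (hLc.preimage (lp.isometry_single i).continuous) y
    exact Submodule.le_topologicalClosure _ (Submodule.subset_span ⟨i, y, hy, rfl⟩)
  rw [Submodule.dense_iff_topologicalClosure_eq_top, eq_top_iff]
  intro x _
  exact hLc.mem_of_tendsto (lp.hasSum_single (by norm_num) x)
    (Filter.Eventually.of_forall fun s => L.sum_mem fun i _ => h1 i _)

end DirectSum

/-! ### Transport along isometries -/

section IsometryConjugation

open ContinuousLinearMap

variable {H₁ H₂ H : Type*} [NormedAddCommGroup H₁] [InnerProductSpace ℂ H₁]
  [NormedAddCommGroup H₂] [InnerProductSpace ℂ H₂] [CompleteSpace H₂]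
  [NormedAddCommGroup H] [InnerProductSpace ℂ H] [CompleteSpace H]

theorem adjoint_apply_linearIsometry [CompleteSpace H₁] (W : H₁ →ₗᵢ[ℂ] H) (x : H₁) :
    adjoint W.toContinuousLinearMap (W x) = x := by
  refine ext_inner_right ℂ fun y => ?_
  rw [adjoint_inner_left]
  exact W.inner_map_map x y

/-- The representation `a ↦ W π(a) W^*` for an isometry `W`. -/
noncomputable def conjIsometry [CompleteSpace H₁] {A : Type*} [NonUnitalCStarAlgebra A] (W : H₁ →ₗᵢ[ℂ] H)
    (π : A →⋆ₙₐ[ℂ] (H₁ →L[ℂ] H₁)) : A →⋆ₙₐ[ℂ] (H →L[ℂ] H) where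
  toFun a := W.toContinuousLinearMap ∘L π a ∘L adjoint W.toContinuousLinearMap
  map_smul' c a := by ext x; simp
  map_zero' := by ext x; simp
  map_add' a b := by ext x; simp
  map_mul' a b := by
    ext x
    simp [adjoint_apply_linearIsometry]
  map_star' a := by
    rw [map_star, star_eq_adjoint, star_eq_adjoint, adjoint_comp, adjoint_comp, adjoint_adjoint]
    rfl

theorem conjIsometry_apply [CompleteSpace H₁] {A : Type*} [NonUnitalCStarAlgebra A] (W : H₁ →ₗᵢ[ℂ] H)
    (π : A →⋆ₙₐ[ℂ] (H₁ →L[ℂ] H₁)) (a : A) (x : H) :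
    conjIsometry W π a x = W (π a (adjoint W.toContinuousLinearMap x)) := rfl

theorem norm_conj_isometries (W : H₁ →ₗᵢ[ℂ] H) (U : H₂ →ₗᵢ[ℂ] H) (T : H₂ →L[ℂ] H₁) :
    ‖W.toContinuousLinearMap ∘L T ∘L adjoint U.toContinuousLinearMap‖ = ‖T‖ := by
  refine le_antisymm ?_ ?_
  · refine opNorm_le_bound _ (norm_nonneg _) fun x => ?_
    have h1 : ‖adjoint U.toContinuousLinearMap x‖ ≤ ‖x‖ := by
      refine (le_of_opNorm_le (c := 1) _ ?_ x).trans (one_mul _).le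
      rw [LinearIsometryEquiv.norm_map]
      exact U.norm_toContinuousLinearMap_le
    calc ‖W (T (adjoint U.toContinuousLinearMap x))‖ = ‖T (adjoint U.toContinuousLinearMap x)‖ :=
          W.norm_map _
      _ ≤ ‖T‖ * ‖adjoint U.toContinuousLinearMap x‖ := le_opNorm _ _
      _ ≤ ‖T‖ * ‖x‖ := by gcongr
  · refine opNorm_le_bound _ (norm_nonneg _) fun x => ?_
    have h1 : ‖T x‖ = ‖(W.toContinuousLinearMap ∘L T ∘L adjoint U.toContinuousLinearMap) (U x)‖ := by
      change _ = ‖W (T (adjoint U.toContinuousLinearMap (U x)))‖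
      rw [adjoint_apply_linearIsometry, W.norm_map]
    rw [h1]
    exact (le_opNorm _ _).trans_eq (by rw [U.norm_map])

end IsometryConjugation

/-! ### The isometric weak* continuous representation -/

section Representation

open ContinuousLinearMap
open scoped ComplexOrder

theorem clm_ext_of_denseRange {E G H K : Type*} [NormedAddCommGroup H] [InnerProductSpace ℂ H]
    [NormedAddCommGroup K] [InnerProductSpace ℂ K] {i : E → H} (hi : DenseRange i) {j : G → K}
    (hj : DenseRange j) {S T : K →L[ℂ] H}
    (h : ∀ x y, inner ℂ (i x) (S (j y)) = inner ℂ (i x) (T (j y))) : S = T := by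
  refine ContinuousLinearMap.coeFn_injective
    (hj.equalizer S.continuous T.continuous (funext fun y => ?_))
  exact Dense.eq_of_inner_right ℂ hi (by rintro _ ⟨x, rfl⟩; exact h x y)

theorem inner_starAlgHom_apply {A H : Type*} [NonUnitalCStarAlgebra A] [NormedAddCommGroup H]
    [InnerProductSpace ℂ H] [CompleteSpace H] (π : A →⋆ₙₐ[ℂ] (H →L[ℂ] H)) (a : A) (x y : H) :
    inner ℂ x (π a y) = inner ℂ (π (star a) x) y := by
  rw [map_star, star_eq_adjoint, adjoint_inner_left]

/-- The isometric inclusion of the first summand of a Hilbert space direct sum. -/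
noncomputable def inlIsometry (H K : Type*) [NormedAddCommGroup H] [InnerProductSpace ℂ H]
    [NormedAddCommGroup K] [InnerProductSpace ℂ K] : H →ₗᵢ[ℂ] WithLp 2 (H × K) where
  toLinearMap := (WithLp.linearEquiv 2 ℂ (H × K)).symm.toLinearMap ∘ₗ LinearMap.inl ℂ H K
  norm_map' x := WithLp.norm_toLp_fst 2 H K x

/-- The isometric inclusion of the second summand of a Hilbert space direct sum. -/
noncomputable def inrIsometry (H K : Type*) [NormedAddCommGroup H] [InnerProductSpace ℂ H]
    [NormedAddCommGroup K] [InnerProductSpace ℂ K] : K →ₗᵢ[ℂ] WithLp 2 (H × K) where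
  toLinearMap := (WithLp.linearEquiv 2 ℂ (H × K)).symm.toLinearMap ∘ₗ LinearMap.inr ℂ H K
  norm_map' x := WithLp.norm_toLp_snd 2 H K x

namespace CStarBimodule

/-- The operators on GNS spaces given by a functional satisfying a Cauchy–Schwarz inequality. -/
theorem exists_gns_operator {A B V : Type*} [NonUnitalCStarAlgebra A] [NonUnitalCStarAlgebra B]
    [NormedAddCommGroup V] [NormedSpace ℂ V] (M : CStarBimodule A B V)
    [PartialOrder A] [StarOrderedRing A] [PartialOrder B] [StarOrderedRing B]
    (F : StrongDual ℂ V) (φ : A →ₚ[ℂ] ℂ) (ψ : B →ₚ[ℂ] ℂ)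
    (h : ∀ a b v, ‖F (M.lact a (M.ract b v))‖ ≤
        ‖v‖ * √(φ (a * star a)).re * √(ψ (star b * b)).re) :
    ∃ J : V →ₗ[ℂ] (ψ.GNS →L[ℂ] φ.GNS),
      (∀ v x y, inner ℂ (φ.gnsMap x) (J v (ψ.gnsMap y)) = F (M.lact (star x) (M.ract y v))) ∧
      (∀ v, ‖J v‖ ≤ ‖v‖) ∧ (∀ a v, J (M.lact a v) = φ.gnsNonUnitalStarAlgHom a ∘L J v) ∧
      ∀ b v, J (M.ract b v) = J v ∘L ψ.gnsNonUnitalStarAlgHom b := by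
  have hex : ∀ v, ∃ T : ψ.GNS →L[ℂ] φ.GNS,
      (∀ x y, inner ℂ (φ.gnsMap x) (T (ψ.gnsMap y)) = F (M.lact (star x) (M.ract y v))) ∧
      ‖T‖ ≤ ‖v‖ := fun v => by
    let β : A →ₗ⋆[ℂ] B →ₗ[ℂ] ℂ := LinearMap.mk₂'ₛₗ (starRingEnd ℂ) (RingHom.id ℂ)
      (fun x y => F (M.lact (star x) (M.ract y v))) (by intros; simp) (by intros; simp)
      (by intros; simp) (by intros; simp)
    refine exists_clm_of_sesquilinear_bound φ.gnsMap φ.denseRange_gnsMap ψ.gnsMap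
      ψ.denseRange_gnsMap β (norm_nonneg v) fun x y => ?_
    rw [PositiveLinearMap.norm_gnsMap, PositiveLinearMap.norm_gnsMap]
    have h1 := h (star x) y v
    rw [star_star] at h1
    exact h1
  choose J hJ hJn using hex
  have ext : ∀ {S T : ψ.GNS →L[ℂ] φ.GNS}, (∀ x y, inner ℂ (φ.gnsMap x) (S (ψ.gnsMap y))
      = inner ℂ (φ.gnsMap x) (T (ψ.gnsMap y))) → S = T :=
    clm_ext_of_denseRange φ.denseRange_gnsMap ψ.denseRange_gnsMap
  refine ⟨{ toFun := J
            map_add' := fun v w => ext fun x y => ?_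
            map_smul' := fun c v => ext fun x y => ?_ }, hJ, hJn,
          fun a v => ext fun x y => ?_, fun b v => ext fun x y => ?_⟩
  · simp [inner_add_right, hJ]
  · simp [inner_smul_right, hJ]
  · change inner ℂ _ (J (M.lact a v) _) = inner ℂ _ (φ.gnsNonUnitalStarAlgHom a (J v _))
    rw [inner_starAlgHom_apply,
      PositiveLinearMap.gnsNonUnitalStarAlgHom_gnsMap, hJ, hJ, star_mul, star_star, M.lact_mul,
      ← M.lact_ract a]
  · change inner ℂ _ (J (M.ract b v) _) = inner ℂ _ (J v (ψ.gnsNonUnitalStarAlgHom b _))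
    rw [PositiveLinearMap.gnsNonUnitalStarAlgHom_gnsMap, hJ, hJ, M.ract_mul]

variable {A : Type u} {B : Type v} {V : Type w}
    [NonUnitalCStarAlgebra A] [NonUnitalCStarAlgebra B]
    [NormedAddCommGroup V] [NormedSpace ℂ V]
    {M : CStarBimodule A B V} {PV : Submodule ℂ (StrongDual ℂ V)}

/-- A dual representable bimodule has an isometric representation whose coefficient functionals
belong to the predual. -/
theorem IsDualRepresentable.exists_representation (hM : M.IsDualRepresentable PV)
    [PartialOrder A] [StarOrderedRing A] [PartialOrder B] [StarOrderedRing B] :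
    ∃ (H : Type (max u v w)) (_ : NormedAddCommGroup H) (_ : InnerProductSpace ℂ H)
      (_ : CompleteSpace H)
      (π : A →⋆ₙₐ[ℂ] (H →L[ℂ] H)) (ρ : B →⋆ₙₐ[ℂ] (H →L[ℂ] H))
      (J : V →ₗᵢ[ℂ] (H →L[ℂ] H)),
      (∀ η ξ, coeffFunctional J.toContinuousLinearMap η ξ ∈ PV) ∧
      (∀ (a : A) (v : V), J (M.lact a v) = π a * J v) ∧
      (∀ (v : V) (b : B), J (M.ract b v) = J v * ρ b) := by
  classical
  let ι := {F : StrongDual ℂ V // F ∈ PV ∧ ‖F‖ ≤ 1}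
  choose φ ψ hφ hψ hF using fun F : ι =>
    hM.representable.propertyR.exists_positiveLinearMap F.2.2
  choose J hJ hJn hJl hJr using fun F : ι => M.exists_gns_operator F.1 (φ F) (ψ F) (hF F)
  obtain ⟨π, hπ⟩ := exists_directSum_starAlgHom fun F : ι => (φ F).gnsNonUnitalStarAlgHom
  obtain ⟨ρ, hρ⟩ := exists_directSum_starAlgHom fun F : ι => (ψ F).gnsNonUnitalStarAlgHom
  obtain ⟨Φ, hΦ, hΦn, hΦJ⟩ := exists_directSum_clm J hJn
  have hl : ∀ a v, Φ (M.lact a v) = π a ∘L Φ v := fun a v => by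
    ext x F
    rw [hΦ, hJl, ContinuousLinearMap.comp_apply, ContinuousLinearMap.comp_apply, hπ, hΦ]
  have hr : ∀ v b, Φ (M.ract b v) = Φ v ∘L ρ b := fun v b => by
    ext x F
    rw [hΦ, hJr, ContinuousLinearMap.comp_apply, ContinuousLinearMap.comp_apply, hΦ, hρ]
  -- F(avb) is the coefficient of `J F v` at the GNS vectors of a* and b, which have norm at most 1
  -- when a and b do.
  have hFJ : ∀ (F : ι) v, ‖F.1 v‖ ≤ ‖J F v‖ := fun F v =>
    hM.norm_apply_le_of_lact_ract F.1 v fun a b ha hb => by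
      have h1 : ‖(φ F).gnsMap (star a)‖ ≤ 1 := by
        rw [PositiveLinearMap.norm_gnsMap, Real.sqrt_le_one]
        refine (hφ F _).trans (pow_le_one₀ (norm_nonneg _) ?_)
        rwa [norm_star]
      have h2 : ‖(ψ F).gnsMap b‖ ≤ 1 := by
        rw [PositiveLinearMap.norm_gnsMap, Real.sqrt_le_one]
        exact (hψ F _).trans (pow_le_one₀ (norm_nonneg _) hb)
      have h3 := hJ F v (star a) b
      rw [star_star] at h3
      rw [← h3]
      calc _ ≤ ‖(φ F).gnsMap (star a)‖ * ‖J F v ((ψ F).gnsMap b)‖ := norm_inner_le_norm _ _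
        _ ≤ 1 * (‖J F v‖ * 1) := by
          gcongr
          exact (le_opNorm _ _).trans (by gcongr)
        _ = _ := by ring
  have hiso : ∀ v, ‖Φ v‖ = ‖v‖ := fun v => by
    refine le_antisymm (hΦn v) ((hM.isPredual.isometry v).2 ?_)
    rintro _ ⟨F, hF, hF1, rfl⟩
    exact (hFJ ⟨F, hF, hF1⟩ v).trans (hΦJ _ v)
  have hcoef : ∀ η ξ, coeffFunctional (Φ.mkContinuous 1 fun v => by rw [hiso, one_mul]) η ξ ∈ PV := by
    refine coeffFunctional_mem_of_total _ hM.isPredual.isClosed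
      (dense_span_lp_single (fun F => Set.range (φ F).gnsMap) fun F => (φ F).denseRange_gnsMap)
      (dense_span_lp_single (fun F => Set.range (ψ F).gnsMap) fun F => (ψ F).denseRange_gnsMap) ?_
    rintro _ ⟨F, _, ⟨x, rfl⟩, rfl⟩ _ ⟨F', _, ⟨y, rfl⟩, rfl⟩
    have h1 : ∀ v, inner ℂ (lp.single (E := fun F : ι => (φ F).GNS) 2 F ((φ F).gnsMap x)) (Φ v (lp.single (E := fun F : ι => (ψ F).GNS) 2 F' ((ψ F').gnsMap y)))
        = inner ℂ ((φ F).gnsMap x) (J F v (lp.single (E := fun F : ι => (ψ F).GNS) 2 F' ((ψ F').gnsMap y) F)) := fun v => by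
      rw [lp.inner_single_left, hΦ]
    -- The summed operator is diagonal: coefficients within one summand are the functionals v ↦
    -- F(x*vy), and those across summands vanish.
    by_cases hFF : F = F'
    · subst hFF
      obtain ⟨G, hG, hGv⟩ := hM.exists_mem_eq_lact_ract F.2.1 (star x) y
      convert hG
      ext v
      refine (h1 v).trans ?_
      rw [lp.single_apply_self, hJ, hGv]
    · convert PV.zero_mem
      ext v
      refine (h1 v).trans ?_
      rw [lp.single_apply_ne _ _ _ hFF]
      simp
  -- `A` and `B` act on different Hilbert spaces; both are placed in one sum, with each
  -- representation extended by zero, hence possibly degenerate.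
  let W := inlIsometry (lp (fun F : ι => (φ F).GNS) 2) (lp (fun F : ι => (ψ F).GNS) 2)
  let U := inrIsometry (lp (fun F : ι => (φ F).GNS) 2) (lp (fun F : ι => (ψ F).GNS) 2)
  refine ⟨WithLp 2 (lp (fun F : ι => (φ F).GNS) 2 × lp (fun F : ι => (ψ F).GNS) 2), inferInstance,
    inferInstance, inferInstance, conjIsometry W π, conjIsometry U ρ,
    { toFun := fun v => W.toContinuousLinearMap ∘L Φ v ∘L adjoint U.toContinuousLinearMap
      map_add' := fun v w => by ext1 x; simp
      map_smul' := fun c v => by ext1 x; simp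
      norm_map' := fun v => (norm_conj_isometries W U (Φ v)).trans (hiso v) }, ?_, ?_, ?_⟩
  · intro η ξ
    convert hcoef (adjoint W.toContinuousLinearMap η) (adjoint U.toContinuousLinearMap ξ)
    ext v
    change inner ℂ η (W (Φ v _)) = inner ℂ (adjoint W.toContinuousLinearMap η) (Φ v _)
    rw [adjoint_inner_left]
    rfl
  · intro a v
    ext1 x
    change W (Φ (M.lact a v) _) = conjIsometry W π a (W (Φ v _))
    rw [conjIsometry_apply, adjoint_apply_linearIsometry, hl]
    rfl
  · intro v b
    ext1 x
    change W (Φ (M.ract b v) _) = W (Φ v (adjoint U.toContinuousLinearMap (conjIsometry U ρ b x)))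
    rw [conjIsometry_apply, adjoint_apply_linearIsometry, hr]
    rfl

end CStarBimodule

end Representation

/-! ### Normality of representations and the final theorem -/

section Normality

open ContinuousLinearMap

/-- A representation is normal if its coefficient functionals for a total set of vectors are. -/
theorem isNormalRep_of_total {A H : Type*} [NonUnitalCStarAlgebra A] [NormedAddCommGroup H]
    [InnerProductSpace ℂ H] [CompleteSpace H] {PA : Submodule ℂ (StrongDual ℂ A)}
    (hPA : IsClosed (PA : Set (StrongDual ℂ A))) (π : A →⋆ₙₐ[ℂ] (H →L[ℂ] H)) {S R : Set H}
    (hS : Dense (Submodule.span ℂ S : Set H)) (hR : Dense (Submodule.span ℂ R : Set H))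
    (h : ∀ η ∈ S, ∀ ξ ∈ R, ∃ f ∈ PA, ∀ a, f a = inner ℂ η (π a ξ)) : IsNormalRep PA π := by
  let p : A →L[ℂ] (H →L[ℂ] H) := LinearMap.mkContinuous
    { toFun := π, map_add' := map_add π, map_smul' := map_smul π } 1 fun a => by
      rw [one_mul]
      exact NonUnitalStarAlgHom.norm_apply_le π a
  have h1 : ∀ η ξ, coeffFunctional p η ξ ∈ PA :=
    coeffFunctional_mem_of_total p hPA hS hR fun η hη ξ hξ => by
      obtain ⟨f, hf, hfa⟩ := h η hη ξ hξ
      convert hf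
      ext a
      exact (hfa a).symm
  exact continuous_weakTopologyOf_of_comp_mem _ fun ω hω =>
    ⟨ω ∘L p, comp_mem_of_coeffFunctional_mem p hPA h1 hω, fun a => rfl⟩

end Normality

theorem mainTheorem7 {A : Type u} {B : Type v} {V : Type w}
    [NonUnitalCStarAlgebra A] [NonUnitalCStarAlgebra B]
    [NormedAddCommGroup V] [NormedSpace ℂ V]
    (M : CStarBimodule A B V) (PV : Submodule ℂ (StrongDual ℂ V))
    (hM : M.IsDualRepresentable PV) :
    ∃ (H : Type (max u v w)) (_ : NormedAddCommGroup H) (_ : InnerProductSpace ℂ H)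
      (_ : CompleteSpace H)
      (π : A →⋆ₙₐ[ℂ] (H →L[ℂ] H)) (ρ : B →⋆ₙₐ[ℂ] (H →L[ℂ] H))
      (J : V →ₗᵢ[ℂ] (H →L[ℂ] H)),
      @Continuous V (H →L[ℂ] H) (weakTopologyOf (PV : Set (StrongDual ℂ V)))
        (weakTopologyOf (normalFunctionals H)) J ∧
      (∀ (a : A) (v : V), J (M.lact a v) = π a * J v) ∧
      (∀ (v : V) (b : B), J (M.ract b v) = J v * ρ b) ∧
      (∀ (a : A) (v : V) (b : B), J (M.lact a (M.ract b v)) = π a * J v * ρ b) ∧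
      (∀ PA : Submodule ℂ (StrongDual ℂ A), M.IsLeftNormal PV PA → IsNormalRep PA π) ∧
      (∀ PB : Submodule ℂ (StrongDual ℂ B), M.IsRightNormal PV PB → IsNormalRep PB ρ) := by
  let _ : PartialOrder A := CStarAlgebra.spectralOrder A
  have _ : StarOrderedRing A := CStarAlgebra.spectralOrderedRing A
  let _ : PartialOrder B := CStarAlgebra.spectralOrder B
  have _ : StarOrderedRing B := CStarAlgebra.spectralOrderedRing B
  obtain ⟨H, _, _, _, π, ρ, J, hJ, hl, hr⟩ := hM.exists_representation
  -- The vectors J(v)ξ form an invariant set because π(a)J(v)ξ = J(av)ξ.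
  obtain ⟨π', hπ', S, hSd, hS⟩ := exists_compression π {x | ∃ v ξ, x = J v ξ} (by
    rintro a _ ⟨v, ξ, rfl⟩
    refine ⟨M.lact a v, ξ, ?_⟩
    rw [hl]
    rfl)
  have hr' : ∀ v b ζ, ρ b (star (J v) ζ) = star (J (M.ract (star b) v)) ζ := fun v b ζ => by
    rw [hr, star_mul, ← map_star ρ, star_star]
    rfl
  obtain ⟨ρ', hρ', R, hRd, hR⟩ := exists_compression ρ {x | ∃ v ζ, x = star (J v) ζ} (by
    rintro b _ ⟨v, ζ, rfl⟩
    exact ⟨M.ract (star b) v, ζ, hr' v b ζ⟩)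
  have hl2 : ∀ a v, J (M.lact a v) = π' a * J v := fun a v => by
    rw [hl]
    ext x
    exact (hπ' a _ ⟨v, x, rfl⟩).symm
  -- `ρ'` is known to agree with `ρ` only on the ranges of the J(v)*, so the identity is checked
  -- after taking adjoints.
  have hr2 : ∀ v b, J (M.ract b v) = J v * ρ' b := fun v b => by
    have h1 : star (J (M.ract b v)) = star (J v * ρ' b) := by
      rw [star_mul, ← map_star ρ']
      ext ζ
      change _ = ρ' (star b) (star (J v) ζ)
      rw [hρ' _ _ ⟨v, ζ, rfl⟩, hr', star_star]
    exact star_injective h1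
  refine ⟨H, inferInstance, inferInstance, inferInstance, π', ρ', J, ?_, hl2, hr2, ?_, ?_, ?_⟩
  · exact continuous_weakTopologyOf_of_comp_mem _ fun ω hω =>
      ⟨ω ∘L J.toContinuousLinearMap,
        comp_mem_of_coeffFunctional_mem _ hM.isPredual.isClosed hJ hω, fun v => rfl⟩
  · intro a v b
    rw [hl2, hr2, mul_assoc]
  · intro PA hPA
    have hd : Dense ((Submodule.span ℂ Set.univ : Submodule ℂ H) : Set H) := by simp
    -- At ξ = J(v)ζ the coefficient is a ↦ G(av), with G the coefficient functional of `J` at (η,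
    -- ζ); G lies in `V_*`, so left normality applies. The other vectors of `S` are killed by `π'`.
    refine isNormalRep_of_total hPA.isPredual.isClosed π' hd hSd fun η _ ξ hξ => ?_
    rcases hS ξ hξ with ⟨v, ζ, rfl⟩ | h0
    · obtain ⟨f, hf, hfa⟩ := hPA.normal _ (hJ η ζ) v
      refine ⟨f, hf, fun a => ?_⟩
      rw [hfa, coeffFunctional_apply]
      change inner ℂ η (J (M.lact a v) ζ) = _
      rw [hl2]
      rfl
    · exact ⟨0, PA.zero_mem, fun a => by simp [h0]⟩
  · intro PB hPB
    have hd : Dense ((Submodule.span ℂ Set.univ : Submodule ℂ H) : Set H) := by simp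
    -- Here the left vector is restricted: η = J(v)*ζ gives ⟪η, ρ'(b)ξ⟫ = ⟪ζ, J(vb)ξ⟫.
    refine isNormalRep_of_total hPB.isPredual.isClosed ρ' hRd hd fun η hη ξ _ => ?_
    have hadj : ∀ b, inner ℂ η (ρ' b ξ) = inner ℂ (ρ' (star b) η) ξ := fun b =>
      inner_starAlgHom_apply ρ' b η ξ
    rcases hR η hη with ⟨v, ζ, rfl⟩ | h0
    · obtain ⟨f, hf, hfb⟩ := hPB.normal _ (hJ ζ ξ) v
      refine ⟨f, hf, fun b => ?_⟩
      rw [hfb, coeffFunctional_apply, ContinuousLinearMap.star_eq_adjoint,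
        ContinuousLinearMap.adjoint_inner_left]
      change inner ℂ ζ (J (M.ract b v) ξ) = _
      rw [hr2]
      rfl
    · exact ⟨0, PB.zero_mem, fun b => by simp [hadj, h0]⟩
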